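/- Write $r=\sqrt{x_1^2+x_2^2}$ and $z=x_3$ for $x\in\mathbb{R}^3$; a function on $\mathbb{R}^3$ is axisymmetric if it depends on $(r,z)$ only, and $\partial_r=\frac{x_1}{r}\partial_{x_1}+\frac{x_2}{r}\partial_{x_2}$. Proposition. There is a universal constant $C>0$ such that the following holds for every $1\le p\le\infty$. Let $\omega_0=\omega_0(r,z)$ and $\rho_0=\rho_0(r,z)$ be axisymmetric with $\rho_0,\ \Pi_0:=\frac{\omega_0}{r}\in L^1(\mathbb{R}^3)$, and put $\Gamma_0=\Pi_0-\frac{\rho_0}{2}$. Let $0<T\le\infty$, and let $v$ be a $C^\infty$ vector field on $(0,T)\times\mathbb{R}^3$ with $\operatorname{div}v(t)=0$ for all $t\in(0,T)$, which grows at most linearly in $x$ locally uniformly in time: for all $0<a\le b<T$ there is $K$ with $|v(t,x)|\le K(1+|x|)$ for all $t\in[a,b]$, $x\in\mathbb{R}^3$ (for instance, $v$ bounded on $[a,b]\times\mathbb{R}^3$ for all such $a,b$). Let $\Gamma\in C([0,T);L^1(\mathbb{R}^3))$ be a smooth solution of the $\Gamma$ equation, that is: $\Gamma$ is $C^\infty$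 and axisymmetric on $(0,T)\times\mathbb{R}^3$, satisfies $$\partial_t\Gamma+v\cdot\nabla\Gamma-\Big(\Delta+\frac{2}{r}\partial_r\Big)\Gamma=0$$ at all points of $(0,T)\times\mathbb{R}^3$ with $r>0$, and $\Gamma(0)=\Gamma_0$. Then for all $t\in(0,T)$ $$\|\Gamma(t)\|_{L^p(\mathbb{R}^3)}\le \frac{C}{t^{\frac32(1-\frac1p)}}\,\|\Gamma_0\|_{L^1(\mathbb{R}^3)} .$$ The constant $C$ does not depend on $p$, $T$, $v$, $\omega_0$, $\rho_0$ or $\Gamma$. -/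

import Mathlib

open MeasureTheory Filter Topology Set
open scoped ENNReal ContDiff

noncomputable section

namespace GammaEq

/-- Physical space `ℝ³`, with Euclidean norm and Lebesgue measure `volume`. -/
abbrev E3 : Type := EuclideanSpace ℝ (Fin 3)

/-- Distance to the axis: `r = √(x₁² + x₂²)`. -/
def rad (x : E3) : ℝ := Real.sqrt (x 0 ^ 2 + x 1 ^ 2)

/-- The height `z`, the third Cartesian coordinate. -/
def height (x : E3) : ℝ := x 2

/-- The radial unit vector `e_r = (x₁ / r, x₂ / r, 0)`; only used where `r > 0`. -/
def eR (x : E3) : E3 := !₂[x 0 / rad x, x 1 / rad x, 0]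

/-- The radial derivative `∂_r f`; only used where `r > 0`. -/
def radialDeriv (f : E3 → ℝ) (x : E3) : ℝ := fderiv ℝ f x (eR x)

/-- The divergence of a vector field on `ℝ³`. -/
def divergence (w : E3 → E3) (x : E3) : ℝ :=
  ∑ i : Fin 3, fderiv ℝ w x (EuclideanSpace.single i 1) i

/-- `f` is axisymmetric: it depends on `(r, z)` only. -/
def IsAxisymmetric (f : E3 → ℝ) : Prop :=
  ∀ x y : E3, rad x = rad y → height x = height y → f x = f y

/-- The open time interval `(0, T)`, where `0 < T ≤ ∞`. -/
def openTimes (T : EReal) : Set ℝ := {t : ℝ | 0 < t ∧ (t : EReal) < T}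

/-- The half-open time interval `[0, T)`, where `0 < T ≤ ∞`. -/
def times (T : EReal) : Set ℝ := {t : ℝ | 0 ≤ t ∧ (t : EReal) < T}

/-- A smooth divergence-free velocity field on `(0, T) × ℝ³`, which at infinity grows at most
linearly in `x`, locally uniformly in `t ∈ (0, T)` (bounded fields are a special case; nothing is
required uniformly as `t → 0` or `t → T`). -/
structure IsVelocity (T : EReal) (v : ℝ → E3 → E3) : Prop where
  smooth : ContDiffOn ℝ ∞ (fun q : ℝ × E3 => v q.1 q.2) (openTimes T ×ˢ univ)
  div_free : ∀ t ∈ openTimes T, ∀ x : E3, divergence (v t) x = 0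
  growth : ∀ a b : ℝ, 0 < a → (b : EReal) < T →
    ∃ K : ℝ, ∀ t ∈ Icc a b, ∀ x : E3, ‖v t x‖ ≤ K * (1 + ‖x‖)

/-- `Γ` is a smooth axisymmetric solution on `(0, T) × ℝ³` of
`∂ₜ Γ + v · ∇Γ - (Δ + (2 / r) ∂_r) Γ = 0`, `Γ(0) = Γ₀`, of class `C([0, T); L¹(ℝ³))`.
The equation is required at the points with `r > 0`, where `(2 / r) ∂_r` makes sense. -/
structure IsSmoothSolution (T : EReal) (v : ℝ → E3 → E3) (Γ₀ : E3 → ℝ) (Γ : ℝ → E3 → ℝ) :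
    Prop where
  smooth : ContDiffOn ℝ ∞ (fun q : ℝ × E3 => Γ q.1 q.2) (openTimes T ×ˢ univ)
  axisymmetric : ∀ t ∈ openTimes T, IsAxisymmetric (Γ t)
  equation : ∀ t ∈ openTimes T, ∀ x : E3, 0 < rad x →
    deriv (fun s => Γ s x) t + fderiv ℝ (Γ t) x (v t x)
      - (Laplacian.laplacian (Γ t) x + 2 / rad x * radialDeriv (Γ t) x) = 0
  integrable : ∀ t ∈ times T, Integrable (Γ t) volume
  continuous_L1 : ∀ t₀ ∈ times T,
    Tendsto (fun t => ∫ x, |Γ t x - Γ t₀ x|) (𝓝[times T] t₀) (𝓝 0)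
  initial : Γ 0 =ᵐ[volume] Γ₀

/-- The initial datum `Π₀ = ω₀ / r` on `ℝ³` of an axisymmetric vorticity `ω₀(r, z)`. -/
def initPi (ω₀ : ℝ → ℝ → ℝ) (x : E3) : ℝ := ω₀ (rad x) (height x) / rad x

/-- The initial density `ρ₀(r, z)` as a function on `ℝ³`. -/
def initRho (ρ₀ : ℝ → ℝ → ℝ) (x : E3) : ℝ := ρ₀ (rad x) (height x)

/-- The initial coupled function `Γ₀ = Π₀ - ρ₀ / 2`. -/
def initGamma (ω₀ ρ₀ : ℝ → ℝ → ℝ) (x : E3) : ℝ := initPi ω₀ x - initRho ρ₀ x / 2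

end GammaEq

end

/-! The proof is an entropy argument followed by Moser iteration. Let `Φ` be convex with `Φ(0) =
Φ'(0) = 0` and test the equation with `Φ'(Γ)`. The drift drops out because `div v = 0`, the
Laplacian yields `-∫ Φ''(Γ) |∇Γ|²`, and the singular term has a sign: `∫ (2/r) ∂_r Φ(Γ) dx` reduces
to minus a positive multiple of the integral of `Φ(Γ)` along the axis. So `∫ Φ(Γ)` decreases and its
loss controls the dissipation, with no constant depending on `v` (`integral_cut_entropy_le`,
`entropy_dissipation`). The computation is done under a cutoff at scale `R`, whose gradient is
`O(1/R)` on `R ≤ |x| ≤ 2R`; this absorbs a linearly growing `v`, and the errors are tails of an `L¹`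
function.

Three families of entropies are used. Smooth approximations of `|y|` give the `L¹` contraction
(`lintegral_abs_le_initial`). The powers `y^(2n)`, with the Sobolev inequality for `Γⁿ`, pass from
`L^(2n)` to `L^(6n)`; iterated along times accumulating at `t`, this gives `L² → L^∞`
(`lintegral_pow_gain`, `ae_sq_le_of_lintegral_sq_le`). For `L¹ → L²` the entropy may grow only
linearly, since `Γ` is known only to lie in `L¹`; a concave-at-infinity power of `Γ` then enters the
Sobolev inequality, at an amplitude adapted to the mass and the elapsed time
(`exists_lintegral_sq_le`).

Together these bound `Γ(t)` in `L^∞` by `C t^(-3/2)` times the initial mass (`exists_ae_abs_le`).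
Interpolation with the `L¹` contraction gives every `p`. -/

noncomputable section

namespace GammaEq

/-! ### Coordinate calculus, integration by parts, and cutoffs on `ℝ³`. -/

section

/-- The partial derivative `∂ᵢ f`. -/
def pd (i : Fin 3) (f : E3 → ℝ) (x : E3) : ℝ := fderiv ℝ f x (EuclideanSpace.single i 1)

/-- The squared length of the gradient. -/
def gradSq (f : E3 → ℝ) (x : E3) : ℝ := ∑ i : Fin 3, pd i f x ^ 2

theorem sum_single (e : E3) : ∑ i : Fin 3, e i • (EuclideanSpace.single i (1 : ℝ) : E3) = e := by
  ext j
  fin_cases j <;> simp [Fin.sum_univ_three]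

theorem fderiv_eq_sum_pd (f : E3 → ℝ) (x e : E3) :
    fderiv ℝ f x e = ∑ i : Fin 3, e i * pd i f x := by
  conv_lhs => rw [← sum_single e]
  simp [pd]

theorem radialDeriv_eq (f : E3 → ℝ) (x : E3) :
    radialDeriv f x = (x 0 * pd 0 f x + x 1 * pd 1 f x) / rad x := by
  simp [radialDeriv, fderiv_eq_sum_pd, Fin.sum_univ_three, eR]
  ring

theorem gradSq_nonneg (f : E3 → ℝ) (x : E3) : 0 ≤ gradSq f x :=
  Finset.sum_nonneg fun _ _ => sq_nonneg _

theorem norm_fderiv_sq_le (f : E3 → ℝ) (x : E3) : ‖fderiv ℝ f x‖ ^ 2 ≤ gradSq f x := by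
  have h : ‖fderiv ℝ f x‖ ≤ √(gradSq f x) := by
    refine ContinuousLinearMap.opNorm_le_bound _ (Real.sqrt_nonneg _) fun e => ?_
    rw [fderiv_eq_sum_pd, EuclideanSpace.norm_eq, ← Real.sqrt_mul (gradSq_nonneg f x)]
    refine Real.abs_le_sqrt ?_
    simp only [Real.norm_eq_abs, sq_abs, gradSq]
    rw [mul_comm]
    exact Finset.sum_mul_sq_le_sq_mul_sq _ _ _
  calc _ ≤ √(gradSq f x) ^ 2 := by gcongr
    _ = _ := Real.sq_sqrt (gradSq_nonneg f x)

theorem contDiff_pd {n : WithTop ℕ∞} {f : E3 → ℝ} (hf : ContDiff ℝ (n + 1) f) (i : Fin 3) :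
    ContDiff ℝ n (pd i f) :=
  (hf.fderiv_right le_rfl).clm_apply contDiff_const

theorem continuous_pd {f : E3 → ℝ} (hf : ContDiff ℝ 1 f) (i : Fin 3) : Continuous (pd i f) :=
  (contDiff_pd (n := 0) (by simpa using hf) i).continuous

theorem laplacian_eq_sum_pd {f : E3 → ℝ} (hf : ContDiff ℝ 2 f) (x : E3) :
    Laplacian.laplacian f x = ∑ i : Fin 3, pd i (pd i f) x := by
  rw [InnerProductSpace.laplacian_eq_iteratedFDeriv_orthonormalBasis f
    (EuclideanSpace.basisFun (Fin 3) ℝ)]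
  refine Finset.sum_congr rfl fun i _ => ?_
  rw [iteratedFDeriv_two_apply]
  have h : DifferentiableAt ℝ (fderiv ℝ f) x :=
    ((hf.fderiv_right (m := 1) (by norm_num)).differentiable (by norm_num)) x
  have h2 : pd i f = fun y => fderiv ℝ f y (EuclideanSpace.single i 1) := rfl
  rw [pd, h2, fderiv_clm_apply h (differentiableAt_const _)]
  simp

theorem pd_mul {f g : E3 → ℝ} {x : E3} (hf : DifferentiableAt ℝ f x)
    (hg : DifferentiableAt ℝ g x) (i : Fin 3) :
    pd i (fun y => f y * g y) x = f x * pd i g x + pd i f x * g x := by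
  rw [pd, fderiv_fun_mul hf hg]
  simp [pd, mul_comm]

theorem pd_comp {Φ : ℝ → ℝ} {f : E3 → ℝ} {x : E3} {d : ℝ} (hΦ : HasDerivAt Φ d (f x))
    (hf : DifferentiableAt ℝ f x) (i : Fin 3) :
    pd i (fun y => Φ (f y)) x = d * pd i f x := by
  have := (hΦ.comp_hasFDerivAt x hf.hasFDerivAt).fderiv
  rw [pd, show (fun y => Φ (f y)) = Φ ∘ f from rfl, this]
  simp [pd]

theorem hasCompactSupport_pd {f : E3 → ℝ} (hf : HasCompactSupport f) (i : Fin 3) :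
    HasCompactSupport (pd i f) :=
  hf.fderiv_apply ℝ _

theorem integrable_mul_of_compactSupport {f g : E3 → ℝ} (hf : Continuous f) (hg : Continuous g)
    (hc : HasCompactSupport f) : Integrable (fun x => f x * g x) :=
  (hf.mul hg).integrable_of_hasCompactSupport hc.mul_right

theorem integral_mul_pd {f g : E3 → ℝ} (hf : ContDiff ℝ 1 f) (hg : ContDiff ℝ 1 g)
    (hc : HasCompactSupport f) (i : Fin 3) :
    ∫ x, f x * pd i g x = -∫ x, pd i f x * g x :=
  integral_mul_fderiv_eq_neg_fderiv_mul_of_integrable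
    (integrable_mul_of_compactSupport (continuous_pd hf i) hg.continuous
      (hasCompactSupport_pd hc i))
    (integrable_mul_of_compactSupport hf.continuous (continuous_pd hg i) hc)
    (integrable_mul_of_compactSupport hf.continuous hg.continuous hc)
    (fun x _ => hf.differentiable (by norm_num) x) (fun x _ => hg.differentiable (by norm_num) x)

theorem norm_sq_eq (x : E3) : ‖x‖ ^ 2 = ∑ i : Fin 3, x i ^ 2 := by
  rw [EuclideanSpace.norm_sq_eq]; simp

theorem coord_sq_le (x : E3) (i : Fin 3) : x i ^ 2 ≤ ‖x‖ ^ 2 := by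
  rw [norm_sq_eq]
  exact Finset.single_le_sum (f := fun i => x i ^ 2) (fun _ _ => sq_nonneg _) (Finset.mem_univ i)

theorem pd_coord (i j : Fin 3) (x : E3) : pd i (fun y => y j) x = if i = j then 1 else 0 := by
  have h : (fun y : E3 => y j) = ⇑(EuclideanSpace.proj j : E3 →L[ℝ] ℝ) := rfl
  rw [pd, h, ContinuousLinearMap.fderiv]
  by_cases hij : i = j
  · subst hij; simp
  · simp [hij, Ne.symm hij]

theorem contDiff_coord {n : WithTop ℕ∞} (j : Fin 3) : ContDiff ℝ n (fun y : E3 => y j) :=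
  (EuclideanSpace.proj j : E3 →L[ℝ] ℝ).contDiff

theorem pd_norm_sq (i : Fin 3) (x : E3) : pd i (fun y => ‖y‖ ^ 2) x = 2 * x i := by
  rw [pd, fderiv_norm_sq_apply]
  simp [EuclideanSpace.inner_single_right]

/-! ### Radial cutoff functions -/

/-- A smooth profile equal to `1` on `[-1, 1]` and vanishing outside `[-2, 2]`. -/
def profile : ContDiffBump (0 : ℝ) := ⟨1, 2, one_pos, one_lt_two⟩

/-- The radial cutoff at scale `R`. -/
def cut (R : ℝ) (x : E3) : ℝ := profile (‖x‖ ^ 2 / R ^ 2)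

theorem contDiff_profile {n : ℕ∞} : ContDiff ℝ n profile := profile.contDiff

theorem exists_profile_bound : ∃ B : ℝ, 0 ≤ B ∧ (∀ s, |deriv profile s| ≤ B) ∧
    ∀ s, |deriv (deriv profile) s| ≤ B := by
  have h1 : ContDiff ℝ 1 (deriv profile) :=
    (contDiff_succ_iff_deriv (n := 1).1 (contDiff_profile (n := 2))).2.2
  have h2 : Continuous (deriv (deriv profile)) := h1.continuous_deriv le_rfl
  obtain ⟨B₁, h₁⟩ := h1.continuous.bounded_above_of_compact_support
    profile.hasCompactSupport.deriv
  obtain ⟨B₂, h₂⟩ := h2.bounded_above_of_compact_support profile.hasCompactSupport.deriv.deriv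
  refine ⟨max B₁ B₂, ?_, fun s => (h₁ s).trans (le_max_left _ _),
    fun s => (h₂ s).trans (le_max_right _ _)⟩
  exact ((norm_nonneg _).trans (h₁ 0)).trans (le_max_left _ _)

theorem contDiff_cut {n : ℕ∞} (R : ℝ) : ContDiff ℝ n (cut R) :=
  contDiff_profile.comp ((contDiff_norm_sq ℝ).div_const _)

theorem cut_nonneg (R : ℝ) (x : E3) : 0 ≤ cut R x := profile.nonneg

theorem cut_le_one (R : ℝ) (x : E3) : cut R x ≤ 1 := profile.le_one

theorem cut_eq_one {R : ℝ} (hR : 0 < R) {x : E3} (hx : ‖x‖ ≤ R) : cut R x = 1 := by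
  refine profile.one_of_mem_closedBall ?_
  rw [mem_closedBall_zero_iff, Real.norm_of_nonneg (by positivity)]
  show _ ≤ (1 : ℝ)
  rw [div_le_one (by positivity)]
  gcongr

theorem cut_eq_zero {R : ℝ} (hR : 0 < R) {x : E3} (hx : 2 * R ≤ ‖x‖) : cut R x = 0 := by
  refine profile.zero_of_le_dist ?_
  rw [dist_zero_right, Real.norm_of_nonneg (by positivity)]
  show (2 : ℝ) ≤ _
  rw [le_div_iff₀ (by positivity)]
  nlinarith

theorem hasCompactSupport_cut {R : ℝ} (hR : 0 < R) : HasCompactSupport (cut R) :=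
  HasCompactSupport.intro (isCompact_closedBall (0 : E3) (2 * R)) fun x hx =>
    cut_eq_zero hR (by simpa using (not_le.1 (by simpa using hx)).le)

theorem pd_cut (R : ℝ) (i : Fin 3) (x : E3) :
    pd i (cut R) x = 2 / R ^ 2 * (x i * deriv profile (‖x‖ ^ 2 / R ^ 2)) := by
  have hd : DifferentiableAt ℝ profile (‖x‖ ^ 2 / R ^ 2) :=
    (contDiff_profile (n := 1)).differentiable (by norm_num) _
  have h1 : DifferentiableAt ℝ (fun y : E3 => ‖y‖ ^ 2) x :=
    (contDiff_norm_sq ℝ (n := 1)).differentiable (by norm_num) x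
  have h := pd_comp (Φ := fun s => profile (s / R ^ 2)) (f := fun y : E3 => ‖y‖ ^ 2) (x := x)
    (hd.hasDerivAt.scomp (h := fun s : ℝ => s / R ^ 2) (‖x‖ ^ 2)
      ((hasDerivAt_id _).div_const (R ^ 2))) h1 i
  rw [show cut R = fun y => profile (‖y‖ ^ 2 / R ^ 2) from rfl, h, pd_norm_sq]
  simp only [smul_eq_mul]
  ring

theorem pd_cut_of_lt {R : ℝ} (hR : 0 < R) (i : Fin 3) {x : E3} (hx : ‖x‖ < R) :
    pd i (cut R) x = 0 := by
  have : cut R =ᶠ[𝓝 x] fun _ => 1 := by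
    filter_upwards [(isOpen_lt continuous_norm continuous_const).mem_nhds hx] with y hy
    exact cut_eq_one hR (le_of_lt hy)
  rw [pd, this.fderiv_eq]
  simp

theorem pd_cut_of_gt {R : ℝ} (hR : 0 < R) (i : Fin 3) {x : E3} (hx : 2 * R < ‖x‖) :
    pd i (cut R) x = 0 := by
  have : cut R =ᶠ[𝓝 x] fun _ => 0 := by
    filter_upwards [(isOpen_lt continuous_const continuous_norm).mem_nhds hx] with y hy
    exact cut_eq_zero hR (le_of_lt hy)
  rw [pd, this.fderiv_eq]
  simp

theorem pd_pd_cut_of_lt {R : ℝ} (hR : 0 < R) (i : Fin 3) {x : E3} (hx : ‖x‖ < R) :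
    pd i (pd i (cut R)) x = 0 := by
  have : pd i (cut R) =ᶠ[𝓝 x] fun _ => 0 := by
    filter_upwards [(isOpen_lt continuous_norm continuous_const).mem_nhds hx] with y hy
    exact pd_cut_of_lt hR i hy
  rw [pd, this.fderiv_eq]
  simp

theorem pd_pd_cut_of_gt {R : ℝ} (hR : 0 < R) (i : Fin 3) {x : E3} (hx : 2 * R < ‖x‖) :
    pd i (pd i (cut R)) x = 0 := by
  have : pd i (cut R) =ᶠ[𝓝 x] fun _ => 0 := by
    filter_upwards [(isOpen_lt continuous_const continuous_norm).mem_nhds hx] with y hy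
    exact pd_cut_of_gt hR i hy
  rw [pd, this.fderiv_eq]
  simp

theorem pd_pd_cut (R : ℝ) (i : Fin 3) (x : E3) :
    pd i (pd i (cut R)) x = 2 / R ^ 2 * (deriv profile (‖x‖ ^ 2 / R ^ 2) +
      x i * (2 / R ^ 2 * (x i * deriv (deriv profile) (‖x‖ ^ 2 / R ^ 2)))) := by
  have hd : ContDiff ℝ 1 (deriv profile) :=
    (contDiff_succ_iff_deriv (n := 1).1 (contDiff_profile (n := 2))).2.2
  have h1 : ContDiff ℝ 1 (fun y : E3 => ‖y‖ ^ 2) := contDiff_norm_sq ℝ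
  have h2 : DifferentiableAt ℝ (deriv profile) (‖x‖ ^ 2 / R ^ 2) :=
    hd.differentiable (by norm_num) _
  have h := pd_comp (Φ := fun s => deriv profile (s / R ^ 2)) (f := fun y : E3 => ‖y‖ ^ 2)
    (x := x) (h2.hasDerivAt.scomp (h := fun s : ℝ => s / R ^ 2) (‖x‖ ^ 2)
      ((hasDerivAt_id _).div_const (R ^ 2))) (h1.differentiable (by norm_num) x) i
  have hc : ContDiff ℝ 1 (fun y : E3 => deriv profile (‖y‖ ^ 2 / R ^ 2)) :=
    hd.comp (h1.div_const _)
  have hx : DifferentiableAt ℝ (fun y : E3 => y i) x :=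
    (contDiff_coord (n := 1) i).differentiable (by norm_num) x
  rw [show pd i (cut R) = fun y => 2 / R ^ 2 * (y i * deriv profile (‖y‖ ^ 2 / R ^ 2)) from
    funext fun y => pd_cut R i y,
    pd_mul (differentiableAt_const _) (hx.fun_mul (hc.differentiable (by norm_num) x)),
    pd_mul hx (hc.differentiable (by norm_num) x), h, pd_coord, pd_norm_sq,
    show pd i (fun _ : E3 => 2 / R ^ 2) x = 0 by simp [pd]]
  simp only [if_true, smul_eq_mul]
  ring

end

/-! ### Size of the cutoff errors, and convex entropies. -/

section

/-- A bound for the first two derivatives of `profile`. -/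
def profileBound : ℝ := exists_profile_bound.choose

theorem profileBound_nonneg : 0 ≤ profileBound := exists_profile_bound.choose_spec.1

theorem abs_deriv_profile_le (s : ℝ) : |deriv profile s| ≤ profileBound :=
  exists_profile_bound.choose_spec.2.1 s

theorem abs_deriv_deriv_profile_le (s : ℝ) : |deriv (deriv profile) s| ≤ profileBound :=
  exists_profile_bound.choose_spec.2.2 s

theorem rad_nonneg (x : E3) : 0 ≤ rad x := Real.sqrt_nonneg _

theorem rad_sq (x : E3) : rad x ^ 2 = x 0 ^ 2 + x 1 ^ 2 := Real.sq_sqrt (by positivity)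

theorem abs_laplacian_cut_le {R : ℝ} (hR : 1 ≤ R) (x : E3) :
    |∑ i, pd i (pd i (cut R)) x| ≤ 22 * profileBound * {x : E3 | R ≤ ‖x‖}.indicator 1 x := by
  have hR0 : 0 < R := by linarith
  have hB := profileBound_nonneg
  by_cases h1 : R ≤ ‖x‖
  swap
  · simp [pd_pd_cut_of_lt hR0 _ (not_le.1 h1), h1]
  rw [indicator_of_mem (by exact h1), Pi.one_apply, mul_one]
  by_cases h2 : ‖x‖ ≤ 2 * R
  swap
  · simp [pd_pd_cut_of_gt hR0 _ (not_le.1 h2), hB]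
  have hn : ∑ i, pd i (pd i (cut R)) x = 2 / R ^ 2 * (3 * deriv profile (‖x‖ ^ 2 / R ^ 2)) +
      4 * (‖x‖ ^ 2 / R ^ 2) * deriv (deriv profile) (‖x‖ ^ 2 / R ^ 2) / R ^ 2 := by
    simp only [pd_pd_cut]
    set d := deriv profile (‖x‖ ^ 2 / R ^ 2)
    set e := deriv (deriv profile) (‖x‖ ^ 2 / R ^ 2)
    rw [norm_sq_eq]
    simp only [Fin.sum_univ_three]
    ring
  have h3 : ‖x‖ ^ 2 / R ^ 2 ≤ 4 := by
    rw [div_le_iff₀ (by positivity)]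
    nlinarith [norm_nonneg x]
  have h4 : 2 / R ^ 2 ≤ 2 := div_le_self (by norm_num) (one_le_pow₀ hR)
  rw [hn]
  calc _ ≤ _ := abs_add_le _ _
    _ = 2 / R ^ 2 * (3 * |deriv profile (‖x‖ ^ 2 / R ^ 2)|) +
      2 * (‖x‖ ^ 2 / R ^ 2) * |deriv (deriv profile) (‖x‖ ^ 2 / R ^ 2)| * (2 / R ^ 2) := by
        simp only [abs_mul, abs_div, abs_of_pos hR0, abs_pow, abs_norm]
        norm_num
        ring
    _ ≤ 2 * (3 * profileBound) + 2 * 4 * profileBound * 2 := by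
        gcongr
        · exact abs_deriv_profile_le _
        · exact abs_deriv_deriv_profile_le _
    _ = _ := by ring

/-- Linear growth is admissible here because the gradient of the cutoff is `O(1/R)` and lives where
`‖x‖` is comparable to `R`: the product stays bounded in `R`. -/
theorem abs_drift_cut_le {R K : ℝ} (hR : 1 ≤ R) (hK : 0 ≤ K) {x w : E3}
    (hw : ‖w‖ ≤ K * (1 + ‖x‖)) :
    |∑ i, w i * pd i (cut R) x| ≤
      12 * K * profileBound * {x : E3 | R ≤ ‖x‖}.indicator 1 x := by
  have hR0 : 0 < R := by linarith
  have hB := profileBound_nonneg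
  by_cases h1 : R ≤ ‖x‖
  swap
  · simp [pd_cut_of_lt hR0 _ (not_le.1 h1), h1]
  rw [indicator_of_mem (by exact h1), Pi.one_apply, mul_one]
  by_cases h2 : ‖x‖ ≤ 2 * R
  swap
  · simp [pd_cut_of_gt hR0 _ (not_le.1 h2)]
    positivity
  have hn : ∑ i, w i * pd i (cut R) x =
      2 / R ^ 2 * (inner ℝ w x * deriv profile (‖x‖ ^ 2 / R ^ 2)) := by
    simp only [pd_cut, PiLp.inner_apply, Fin.sum_univ_three, RCLike.inner_apply, conj_trivial]
    ring
  have hin : |inner ℝ w x| ≤ 6 * K * R ^ 2 := by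
    calc _ ≤ ‖w‖ * ‖x‖ := abs_real_inner_le_norm _ _
      _ ≤ K * (1 + 2 * R) * (2 * R) := by
        gcongr
        exact hw.trans (by gcongr)
      _ ≤ K * (3 * R) * (2 * R) := by
        gcongr
        linarith
      _ = _ := by ring
  rw [hn, abs_mul, abs_mul, abs_of_pos (show 0 < 2 / R ^ 2 by positivity)]
  calc _ ≤ 2 / R ^ 2 * (6 * K * R ^ 2 * profileBound) := by
        gcongr
        exact abs_deriv_profile_le _
    _ = _ := by field_simp; ring

theorem abs_axis_cut_le {R ε : ℝ} (hR : 1 ≤ R) (hε : 0 < ε) (x : E3) :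
    |(x 0 * pd 0 (cut R) x + x 1 * pd 1 (cut R) x) / (x 0 ^ 2 + x 1 ^ 2 + ε)| ≤
      2 * profileBound * {x : E3 | R ≤ ‖x‖}.indicator 1 x := by
  have hR0 : 0 < R := by linarith
  have hB := profileBound_nonneg
  by_cases h1 : R ≤ ‖x‖
  swap
  · simp [pd_cut_of_lt hR0 _ (not_le.1 h1), h1]
  rw [indicator_of_mem (by exact h1), Pi.one_apply, mul_one]
  have hn : (x 0 * pd 0 (cut R) x + x 1 * pd 1 (cut R) x) / (x 0 ^ 2 + x 1 ^ 2 + ε) =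
      2 / R ^ 2 * deriv profile (‖x‖ ^ 2 / R ^ 2) *
        ((x 0 ^ 2 + x 1 ^ 2) / (x 0 ^ 2 + x 1 ^ 2 + ε)) := by
    simp only [pd_cut]
    ring
  have h4 : 2 / R ^ 2 ≤ 2 := div_le_self (by norm_num) (one_le_pow₀ hR)
  have h5 : (x 0 ^ 2 + x 1 ^ 2) / (x 0 ^ 2 + x 1 ^ 2 + ε) ≤ 1 := by
    rw [div_le_one (by positivity)]
    linarith
  rw [hn, abs_mul, abs_mul, abs_of_pos (show 0 < 2 / R ^ 2 by positivity),
    abs_of_nonneg (show 0 ≤ (x 0 ^ 2 + x 1 ^ 2) / (x 0 ^ 2 + x 1 ^ 2 + ε) by positivity)]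
  calc _ ≤ 2 * profileBound * 1 := by
        gcongr
        exact abs_deriv_profile_le _
    _ = _ := by ring

/-- A convex function `Φ` with derivatives `A` and `a`, vanishing to first order at `0`. -/
structure IsEntropy (Φ A a : ℝ → ℝ) : Prop where
  hasDerivAt : ∀ s, HasDerivAt Φ (A s) s
  hasDerivAt' : ∀ s, HasDerivAt A (a s) s
  continuous : Continuous a
  nonneg : ∀ s, 0 ≤ a s
  zero : Φ 0 = 0
  zero' : A 0 = 0

namespace IsEntropy

variable {Φ A a : ℝ → ℝ}

theorem contDiff_deriv (h : IsEntropy Φ A a) : ContDiff ℝ 1 A := by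
  rw [contDiff_one_iff_deriv]
  exact ⟨fun s => (h.hasDerivAt' s).differentiableAt,
    (funext fun s => (h.hasDerivAt' s).deriv : deriv A = a) ▸ h.continuous⟩

theorem contDiff (h : IsEntropy Φ A a) : ContDiff ℝ 1 Φ := by
  rw [contDiff_one_iff_deriv]
  exact ⟨fun s => (h.hasDerivAt s).differentiableAt,
    (funext fun s => (h.hasDerivAt s).deriv : deriv Φ = A) ▸ h.contDiff_deriv.continuous⟩

theorem monotone_deriv (h : IsEntropy Φ A a) : Monotone A :=
  monotone_of_hasDerivAt_nonneg h.hasDerivAt' h.nonneg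

/-- `A` is monotone and vanishes at `0`, so `Φ` has its minimum there. -/
theorem entropy_nonneg (h : IsEntropy Φ A a) (s : ℝ) : 0 ≤ Φ s := by
  rw [← h.zero]
  rcases le_total 0 s with hs | hs
  · refine monotoneOn_of_deriv_nonneg (convex_Ici 0) h.contDiff.continuous.continuousOn
      (h.contDiff.differentiable (by norm_num)).differentiableOn (fun x hx => ?_)
      (self_mem_Ici) hs hs
    rw [(h.hasDerivAt x).deriv, ← h.zero']
    exact h.monotone_deriv (interior_subset hx)
  · refine antitoneOn_of_deriv_nonpos (convex_Iic 0) h.contDiff.continuous.continuousOn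
      (h.contDiff.differentiable (by norm_num)).differentiableOn (fun x hx => ?_)
      hs (self_mem_Iic) hs
    rw [(h.hasDerivAt x).deriv, ← h.zero']
    exact h.monotone_deriv (mem_Iic.1 (interior_subset hx))

theorem entropy_le (h : IsEntropy Φ A a) {L : ℝ} (hL : ∀ s, |A s| ≤ L) (s : ℝ) :
    Φ s ≤ L * |s| := by
  have := convex_univ.norm_image_sub_le_of_norm_hasDerivWithin_le (f := Φ) (f' := A) (C := L)
    (fun x _ => (h.hasDerivAt x).hasDerivWithinAt) (fun x _ => hL x) (mem_univ 0) (mem_univ s)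
  simp only [h.zero, sub_zero, Real.norm_eq_abs] at this
  exact (le_abs_self _).trans this

end IsEntropy

/-! ### Integration by parts against a cutoff -/

variable {Φ A a : ℝ → ℝ} {u χ : E3 → ℝ}

theorem IsEntropy.pd_comp (hP : IsEntropy Φ A a) (hu : ContDiff ℝ 1 u) (i : Fin 3) (x : E3) :
    pd i (fun y => Φ (u y)) x = A (u x) * pd i u x :=
  GammaEq.pd_comp (hP.hasDerivAt _) (hu.differentiable (by norm_num) x) i

theorem integral_cut_pd_pd (hP : IsEntropy Φ A a) (hu : ContDiff ℝ 2 u) (hχ : ContDiff ℝ 2 χ)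
    (hc : HasCompactSupport χ) (i : Fin 3) :
    ∫ x, χ x * A (u x) * pd i (pd i u) x =
      -(∫ x, χ x * (a (u x) * pd i u x ^ 2)) + ∫ x, pd i (pd i χ) x * Φ (u x) := by
  have hu1 : ContDiff ℝ 1 u := hu.of_le (by norm_num)
  have hχ1 : ContDiff ℝ 1 χ := hχ.of_le (by norm_num)
  have hAu : ContDiff ℝ 1 fun x => A (u x) := hP.contDiff_deriv.comp hu1
  have hΦu : ContDiff ℝ 1 fun x => Φ (u x) := hP.contDiff.comp hu1
  rw [integral_mul_pd (f := fun x => χ x * A (u x)) (hχ1.mul hAu)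
    (contDiff_pd (by norm_num; exact hu) i) hc.mul_right i]
  have h1 : ∀ x, pd i (fun x => χ x * A (u x)) x * pd i u x =
      χ x * (a (u x) * pd i u x ^ 2) + pd i χ x * pd i (fun y => Φ (u y)) x := fun x => by
    rw [pd_mul (hχ1.differentiable (by norm_num) x) (hAu.differentiable (by norm_num) x),
      pd_comp (hP.hasDerivAt' _) (hu1.differentiable (by norm_num) x), hP.pd_comp hu1]
    ring
  simp only [h1]
  rw [integral_add, integral_mul_pd (contDiff_pd (by norm_num; exact hχ) i) hΦu
    (hasCompactSupport_pd hc i)]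
  · ring
  · exact integrable_mul_of_compactSupport hχ.continuous
      ((hP.continuous.comp hu.continuous).mul ((continuous_pd hu1 i).pow 2)) hc
  · exact integrable_mul_of_compactSupport (continuous_pd hχ1 i) (continuous_pd hΦu i)
      (hasCompactSupport_pd hc i)

/-- `A(u) ∇u = ∇Φ(u)`, so the field can be moved onto the cutoff. The index set `s` is free so that
the lemma serves both the velocity (all three indices) and the regularized axis field (indices `0`
and `1`). -/
theorem integral_cut_drift (hP : IsEntropy Φ A a) (hu : ContDiff ℝ 1 u) (hχ : ContDiff ℝ 1 χ)
    (hc : HasCompactSupport χ) {w : Fin 3 → E3 → ℝ} (hw : ∀ i, ContDiff ℝ 1 (w i)) (s : Finset (Fin 3)) :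
    ∫ x, χ x * A (u x) * ∑ i ∈ s, w i x * pd i u x =
      -(∫ x, χ x * (∑ i ∈ s, pd i (w i) x) * Φ (u x)) -
        ∫ x, (∑ i ∈ s, w i x * pd i χ x) * Φ (u x) := by
  have hΦu : ContDiff ℝ 1 fun x => Φ (u x) := hP.contDiff.comp hu
  have key : ∀ i, ∫ x, χ x * w i x * pd i (fun y => Φ (u y)) x =
      -(∫ x, χ x * (pd i (w i) x * Φ (u x))) - ∫ x, pd i χ x * (w i x * Φ (u x)) := fun i => by
    rw [integral_mul_pd (hχ.mul (hw i)) hΦu hc.mul_right i, ← neg_add', ← integral_add]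
    · congr 2 with x
      rw [pd_mul (hχ.differentiable (by norm_num) x) ((hw i).differentiable (by norm_num) x)]
      ring
    · exact integrable_mul_of_compactSupport hχ.continuous
        ((continuous_pd (hw i) i).mul hΦu.continuous) hc
    · exact integrable_mul_of_compactSupport (continuous_pd hχ i)
        ((hw i).continuous.mul hΦu.continuous) (hasCompactSupport_pd hc i)
  calc _ = ∫ x, ∑ i ∈ s, χ x * w i x * pd i (fun y => Φ (u y)) x := by
        congr 1 with x
        rw [Finset.mul_sum]
        refine Finset.sum_congr rfl fun i _ => ?_
        rw [hP.pd_comp hu]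
        ring
    _ = ∑ i ∈ s, ∫ x, χ x * w i x * pd i (fun y => Φ (u y)) x :=
        integral_finsetSum _ fun i _ => integrable_mul_of_compactSupport
          (hχ.continuous.mul (hw i).continuous) (continuous_pd hΦu i) hc.mul_right
    _ = -(∑ i ∈ s, ∫ x, χ x * (pd i (w i) x * Φ (u x))) -
        ∑ i ∈ s, ∫ x, pd i χ x * (w i x * Φ (u x)) := by
        simp only [key, Finset.sum_sub_distrib, Finset.sum_neg_distrib]
    _ = _ := by
        have h1 : ∀ i ∈ s, Integrable fun x => χ x * (pd i (w i) x * Φ (u x)) := fun i _ =>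
          integrable_mul_of_compactSupport hχ.continuous
            ((continuous_pd (hw i) i).mul hΦu.continuous) hc
        have h2 : ∀ i ∈ s, Integrable fun x => pd i χ x * (w i x * Φ (u x)) := fun i _ =>
          integrable_mul_of_compactSupport (continuous_pd hχ i)
            ((hw i).continuous.mul hΦu.continuous) (hasCompactSupport_pd hc i)
        rw [← integral_finsetSum _ h1, ← integral_finsetSum _ h2]
        congr 3 <;> ext x
        · rw [Finset.mul_sum, Finset.sum_mul]
          exact Finset.sum_congr rfl fun i _ => by ring
        · rw [Finset.sum_mul]
          exact Finset.sum_congr rfl fun i _ => by ring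

theorem volume_axis : volume {x : E3 | x 0 ^ 2 + x 1 ^ 2 = 0} = 0 := by
  let S : Submodule ℝ E3 := LinearMap.ker (EuclideanSpace.proj (0 : Fin 3) : E3 →L[ℝ] ℝ).toLinearMap
  have hS : S ≠ ⊤ := fun h => by
    have : (EuclideanSpace.single (0 : Fin 3) (1 : ℝ) : E3) ∈ S := h ▸ Submodule.mem_top
    simp [S] at this
  refine measure_mono_null (fun x hx => ?_) (Measure.addHaar_submodule volume S hS)
  have : x 0 = 0 := by
    have : x 0 ^ 2 = 0 := le_antisymm (by nlinarith [sq_nonneg (x 1), hx.out]) (sq_nonneg _)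
    simpa using this
  simpa [S] using this

end

/-! ### The sign of the singular term and the localized entropy inequality. -/

section

variable {Φ A a : ℝ → ℝ} {u χ : E3 → ℝ}

theorem abs_integral_le_tail {R M : ℝ} {c f : E3 → ℝ} (hf : Integrable f) (hf0 : ∀ x, 0 ≤ f x)
    (hc : ∀ x, |c x| ≤ M * {x : E3 | R ≤ ‖x‖}.indicator 1 x) :
    |∫ x, c x * f x| ≤ M * ∫ x in {x : E3 | R ≤ ‖x‖}, f x := by
  have hm : MeasurableSet {x : E3 | R ≤ ‖x‖} := measurableSet_le measurable_const measurable_norm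
  rw [← integral_indicator hm, ← integral_const_mul]
  refine norm_integral_le_of_norm_le (f := fun x => c x * f x) ((hf.indicator hm).const_mul M)
    (Eventually.of_forall fun x => ?_)
  rw [Real.norm_eq_abs, abs_mul, abs_of_nonneg (hf0 x)]
  refine (mul_le_mul_of_nonneg_right (hc x) (hf0 x)).trans_eq ?_
  by_cases hx : R ≤ ‖x‖ <;> simp [indicator, hx]

/-- A regularization of the coordinate field `(x₁, x₂, 0) / r²`. -/
def axisField (ε : ℝ) (i : Fin 3) (x : E3) : ℝ := x i * (x 0 ^ 2 + x 1 ^ 2 + ε)⁻¹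

theorem contDiff_axisDenom {n : WithTop ℕ∞} (ε : ℝ) :
    ContDiff ℝ n fun x : E3 => x 0 ^ 2 + x 1 ^ 2 + ε :=
  (((contDiff_coord 0).pow 2).add ((contDiff_coord 1).pow 2)).add contDiff_const

theorem contDiff_axisField {n : WithTop ℕ∞} {ε : ℝ} (hε : 0 < ε) (i : Fin 3) :
    ContDiff ℝ n (axisField ε i) :=
  (contDiff_coord i).mul ((contDiff_axisDenom ε).inv fun _ => by positivity)

/-- The divergence is `2ε / (r² + ε)²`, a smooth approximation of `2π` times the length measure on
the axis. Its positivity is the favourable sign of `(2/r) ∂_r`. -/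
theorem sum_pd_axisField_nonneg {ε : ℝ} (hε : 0 < ε) (x : E3) :
    0 ≤ ∑ i ∈ {0, 1}, pd i (axisField ε i) x := by
  have hx : ∀ i : Fin 3, DifferentiableAt ℝ (fun y : E3 => y i) x := fun i =>
    (contDiff_coord (n := 1) i).differentiable (by norm_num) x
  have hd : DifferentiableAt ℝ (fun x : E3 => x 0 ^ 2 + x 1 ^ 2 + ε) x :=
    (contDiff_axisDenom (n := 1) ε).differentiable (by norm_num) x
  have hpos : 0 < x 0 ^ 2 + x 1 ^ 2 + ε := by positivity
  have key : ∀ i : Fin 3, i = 0 ∨ i = 1 → pd i (axisField ε i) x =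
      (x 0 ^ 2 + x 1 ^ 2 + ε)⁻¹ - 2 * x i ^ 2 * ((x 0 ^ 2 + x 1 ^ 2 + ε) ^ 2)⁻¹ := fun i hi => by
    have h0 : pd i (fun x : E3 => x 0 ^ 2 + x 1 ^ 2 + ε) x = 2 * x i := by
      have h1 := pd_mul (hx 0) (hx 0) i
      have h2 := pd_mul (hx 1) (hx 1) i
      have h3 : pd i (fun x : E3 => x 0 ^ 2 + x 1 ^ 2 + ε) x =
          pd i (fun x : E3 => x 0 * x 0) x + pd i (fun x : E3 => x 1 * x 1) x := by
        simp only [pd, ← pow_two]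
        rw [fderiv_add_const, fderiv_fun_add ((hx 0).fun_pow 2) ((hx 1).fun_pow 2)]
        rfl
      rw [h3, h1, h2]
      simp only [pd_coord]
      rcases hi with rfl | rfl <;> simp <;> ring
    unfold axisField
    rw [pd_mul (hx i) (hd.fun_inv hpos.ne'), pd_comp (Φ := fun s => s⁻¹) (hasDerivAt_inv hpos.ne') hd,
      h0, pd_coord]
    simp only [if_true]
    ring
  rw [Finset.sum_pair (by decide), key 0 (by simp), key 1 (by simp)]
  have : (x 0 ^ 2 + x 1 ^ 2 + ε)⁻¹ - 2 * x 0 ^ 2 * ((x 0 ^ 2 + x 1 ^ 2 + ε) ^ 2)⁻¹ +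
      ((x 0 ^ 2 + x 1 ^ 2 + ε)⁻¹ - 2 * x 1 ^ 2 * ((x 0 ^ 2 + x 1 ^ 2 + ε) ^ 2)⁻¹) =
      2 * ε * ((x 0 ^ 2 + x 1 ^ 2 + ε) ^ 2)⁻¹ := by
    field_simp
    ring
  rw [this]
  positivity

/-- The singular first-order term `(2 / r) ∂_r`, tested against `A u`, has a favourable sign up to
a contribution from the region where the cutoff is not constant. -/
theorem integral_cut_axis_le (hP : IsEntropy Φ A a) (hu : ContDiff ℝ 1 u) {R : ℝ} (hR : 1 ≤ R)
    {G : E3 → ℝ} (hG : Continuous G)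
    (hGu : ∀ x, (x 0 ^ 2 + x 1 ^ 2) * G x = 2 * (x 0 * pd 0 u x + x 1 * pd 1 u x))
    (hint : Integrable fun x => Φ (u x)) :
    ∫ x, cut R x * A (u x) * G x ≤
      4 * profileBound * ∫ x in {x : E3 | R ≤ ‖x‖}, Φ (u x) := by
  have hR0 : 0 < R := by linarith
  have hc := hasCompactSupport_cut hR0
  have hχ : ContDiff ℝ 1 (cut R) := contDiff_cut (n := 1) R
  have hbase : Continuous fun x => cut R x * A (u x) * G x :=
    (hχ.continuous.mul (hP.contDiff_deriv.continuous.comp hu.continuous)).mul hG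
  have hbasei : Integrable fun x => cut R x * A (u x) * G x :=
    hbase.integrable_of_hasCompactSupport hc.mul_right.mul_right
  have step : ∀ ε : ℝ, 0 < ε →
      ∫ x, cut R x * A (u x) * G x * ((x 0 ^ 2 + x 1 ^ 2) / (x 0 ^ 2 + x 1 ^ 2 + ε)) ≤
        4 * profileBound * ∫ x in {x : E3 | R ≤ ‖x‖}, Φ (u x) := fun ε hε => by
    -- The factor `r² / (r² + ε)` cancels the singularity: by `hGu` the integrand becomes a drift
    -- along the smooth field `axisField ε`.
    have h1 : ∀ x : E3,
        cut R x * A (u x) * G x * ((x 0 ^ 2 + x 1 ^ 2) / (x 0 ^ 2 + x 1 ^ 2 + ε)) =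
        2 * (cut R x * A (u x) * ∑ i ∈ {0, 1}, axisField ε i x * pd i u x) := fun x => by
      rw [Finset.sum_pair (by decide)]
      unfold axisField
      linear_combination cut R x * A (u x) * (x 0 ^ 2 + x 1 ^ 2 + ε)⁻¹ * hGu x
    simp only [h1]
    rw [integral_const_mul, integral_cut_drift hP hu hχ hc (contDiff_axisField hε)]
    have h2 : 0 ≤ ∫ x, cut R x * (∑ i ∈ {0, 1}, pd i (axisField ε i) x) * Φ (u x) :=
      integral_nonneg fun x => mul_nonneg (mul_nonneg (cut_nonneg R x)
        (sum_pd_axisField_nonneg hε x)) (hP.entropy_nonneg _)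
    have h3 := abs_integral_le_tail (R := R) (M := 2 * profileBound)
      (c := fun x => ∑ i ∈ {0, 1}, axisField ε i x * pd i (cut R) x) hint
      (fun x => hP.entropy_nonneg _) fun x => by
        refine le_trans (le_of_eq ?_) (abs_axis_cut_le hR hε x)
        rw [Finset.sum_pair (by decide)]
        unfold axisField
        congr 1
        ring
    have h4 := (abs_le.1 h3).1
    linarith
  have hlim : Tendsto (fun n : ℕ => ∫ x, cut R x * A (u x) * G x *
      ((x 0 ^ 2 + x 1 ^ 2) / (x 0 ^ 2 + x 1 ^ 2 + 1 / ((n : ℝ) + 1)))) atTop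
      (𝓝 (∫ x, cut R x * A (u x) * G x)) := by
    have hn : ∀ n : ℕ, (0 : ℝ) < 1 / ((n : ℝ) + 1) := fun n => by positivity
    -- The factor lies in `[0, 1]` and tends to `1` off the axis, which is a null set.
    refine tendsto_integral_of_dominated_convergence (fun x => |cut R x * A (u x) * G x|)
      (fun n => ?_) hbasei.abs (fun n => Eventually.of_forall fun x => ?_) ?_
    · refine (hbase.mul (Continuous.div ?_ ?_ fun x => ?_)).aestronglyMeasurable
      · exact ((contDiff_coord (n := 0) 0).continuous.pow 2).add
          ((contDiff_coord (n := 0) 1).continuous.pow 2)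
      · exact (contDiff_axisDenom (n := 0) _).continuous
      · have := hn n
        positivity
    · have := hn n
      rw [Real.norm_eq_abs, abs_mul, abs_of_nonneg
        (show 0 ≤ (x 0 ^ 2 + x 1 ^ 2) / (x 0 ^ 2 + x 1 ^ 2 + 1 / ((n : ℝ) + 1)) by positivity)]
      refine mul_le_of_le_one_right (abs_nonneg _) ?_
      rw [div_le_one (by positivity)]
      linarith
    · have : ∀ᵐ x : E3, x 0 ^ 2 + x 1 ^ 2 ≠ 0 := by
        rw [ae_iff]
        simpa using volume_axis
      filter_upwards [this] with x hx
      have h1 : Tendsto (fun n : ℕ => (x 0 ^ 2 + x 1 ^ 2) /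
          (x 0 ^ 2 + x 1 ^ 2 + 1 / ((n : ℝ) + 1))) atTop (𝓝 1) := by
        have := (tendsto_const_nhds (x := x 0 ^ 2 + x 1 ^ 2)).div
          ((tendsto_const_nhds (x := x 0 ^ 2 + x 1 ^ 2)).add
            (tendsto_one_div_add_atTop_nhds_zero_nat (𝕜 := ℝ))) (by simpa using hx)
        rw [add_zero, div_self hx] at this
        exact this
      simpa using h1.const_mul (cut R x * A (u x) * G x)
  exact le_of_tendsto' hlim fun n => step _ (by positivity)

/-- The localized entropy inequality at a fixed time. -/
theorem integral_cut_entropy_le (hP : IsEntropy Φ A a) (hu : ContDiff ℝ 2 u) {R K : ℝ}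
    (hR : 1 ≤ R) (hK : 0 ≤ K) {w : E3 → E3} (hw : ContDiff ℝ 1 w)
    (hdiv : ∀ x, divergence w x = 0) (hgrow : ∀ x, ‖w x‖ ≤ K * (1 + ‖x‖))
    {g : E3 → ℝ} (hg : Continuous g)
    (heq : ∀ x, 0 < rad x → g x + fderiv ℝ u x (w x)
      - (Laplacian.laplacian u x + 2 / rad x * radialDeriv u x) = 0)
    (hint : Integrable fun x => Φ (u x)) :
    ∫ x, cut R x * (A (u x) * g x) ≤ -(∫ x, cut R x * (a (u x) * gradSq u x)) +
      (26 + 12 * K) * profileBound * ∫ x in {x : E3 | R ≤ ‖x‖}, Φ (u x) := by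
  have hR0 : 0 < R := by linarith
  have hc := hasCompactSupport_cut hR0
  have hχ : ContDiff ℝ 1 (cut R) := contDiff_cut (n := 1) R
  have hχ2 : ContDiff ℝ 2 (cut R) := contDiff_cut (n := 2) R
  have hu1 : ContDiff ℝ 1 u := hu.of_le (by norm_num)
  have hwi : ∀ i, ContDiff ℝ 1 fun x => w x i := fun i => (contDiff_coord i).comp hw
  have hAu : Continuous fun x => A (u x) := hP.contDiff_deriv.continuous.comp hu.continuous
  have hdivi : ∀ x, ∑ i, pd i (fun y => w y i) x = 0 := fun x => by
    rw [← hdiv x]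
    refine Finset.sum_congr rfl fun i _ => ?_
    have := ((EuclideanSpace.proj i : E3 →L[ℝ] ℝ).hasFDerivAt.comp x
      (hw.differentiable (by norm_num) x).hasFDerivAt).fderiv
    rw [pd, show (fun y => w y i) = ⇑(EuclideanSpace.proj i : E3 →L[ℝ] ℝ) ∘ w from rfl, this]
    simp
  have hpp : ∀ i, Continuous (pd i (pd i u)) := fun i =>
    continuous_pd (contDiff_pd (by norm_num; exact hu) i) i
  -- Off the axis `G` is `(2/r) ∂_r u`. Defining it by the other terms of the equation makes it
  -- continuous across the axis, where the relation `hGu`, free of division, still holds.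
  let G : E3 → ℝ := fun x => g x + ∑ i, w x i * pd i u x - ∑ i, pd i (pd i u) x
  have hdrc : Continuous fun x => ∑ i, w x i * pd i u x :=
    continuous_finsetSum _ fun i _ => (hwi i).continuous.mul (continuous_pd hu1 i)
  have hlapc : Continuous fun x => ∑ i, pd i (pd i u) x := continuous_finsetSum _ fun i _ => hpp i
  have hG : Continuous G := (hg.add hdrc).sub hlapc
  have hGu : ∀ x, (x 0 ^ 2 + x 1 ^ 2) * G x = 2 * (x 0 * pd 0 u x + x 1 * pd 1 u x) := fun x => by
    rcases (rad_nonneg x).eq_or_lt with h0 | hpos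
    · have h1 : x 0 ^ 2 + x 1 ^ 2 = 0 := by rw [← rad_sq, ← h0]; norm_num
      have h2 : x 0 = 0 := by nlinarith [sq_nonneg (x 0), sq_nonneg (x 1)]
      have h3 : x 1 = 0 := by nlinarith [sq_nonneg (x 0), sq_nonneg (x 1)]
      simp [h2, h3]
    · have h1 := heq x hpos
      rw [fderiv_eq_sum_pd, laplacian_eq_sum_pd hu, radialDeriv_eq] at h1
      have h2 : G x = 2 / rad x * ((x 0 * pd 0 u x + x 1 * pd 1 u x) / rad x) := by
        simp only [G]
        linarith
      rw [h2, ← rad_sq]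
      field_simp [hpos.ne']
  have hax := integral_cut_axis_le hP hu1 hR hG hGu hint
  have hdr := integral_cut_drift hP hu1 hχ hc hwi Finset.univ
  simp only [hdivi, mul_zero, zero_mul, integral_zero, neg_zero, zero_sub] at hdr
  have hdr' := (abs_le.1 (abs_integral_le_tail (R := R) (c := fun x => ∑ i, w x i * pd i (cut R) x)
    hint (fun x => hP.entropy_nonneg _) fun x => abs_drift_cut_le hR hK (hgrow x))).2
  have hlap' := (abs_le.1 (abs_integral_le_tail (R := R) (c := fun x => ∑ i, pd i (pd i (cut R)) x)
    hint (fun x => hP.entropy_nonneg _) fun x => abs_laplacian_cut_le hR x)).2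
  have hint1 : ∀ {f : E3 → ℝ}, Continuous f → Integrable fun x => cut R x * A (u x) * f x :=
    fun hf => integrable_mul_of_compactSupport (hχ.continuous.mul hAu) hf hc.mul_right
  have hlap : ∫ x, cut R x * A (u x) * ∑ i, pd i (pd i u) x =
      -(∫ x, cut R x * (a (u x) * gradSq u x)) +
        ∫ x, (∑ i, pd i (pd i (cut R)) x) * Φ (u x) := by
    simp only [gradSq, Finset.mul_sum, Finset.sum_mul]
    rw [integral_finsetSum _ fun i _ => hint1 (hpp i), integral_finsetSum, integral_finsetSum,
      ← Finset.sum_neg_distrib, ← Finset.sum_add_distrib]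
    · exact Finset.sum_congr rfl fun i _ => integral_cut_pd_pd hP hu hχ2 hc i
    · exact fun i _ => integrable_mul_of_compactSupport
        (continuous_pd (contDiff_pd (by norm_num; exact hχ2) i) i)
        (hP.contDiff.continuous.comp hu.continuous)
        (hasCompactSupport_pd (hasCompactSupport_pd hc i) i)
    · exact fun i _ => integrable_mul_of_compactSupport hχ.continuous
        ((hP.continuous.comp hu.continuous).mul ((continuous_pd hu1 i).pow 2)) hc
  have hsplit : ∫ x, cut R x * (A (u x) * g x) = (∫ x, cut R x * A (u x) * G x) -
      (∫ x, cut R x * A (u x) * ∑ i, w x i * pd i u x) +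
      ∫ x, cut R x * A (u x) * ∑ i, pd i (pd i u) x := by
    rw [← integral_sub (hint1 hG) (hint1 hdrc), ← integral_add _ (hint1 hlapc)]
    · congr 1 with x
      simp only [G]
      ring
    · exact (hint1 hG).sub (hint1 hdrc)
  -- The tail constants add up: 22 from the Laplacian of the cutoff, `12 * K` from the drift and 4
  -- from the axis term.
  rw [hsplit, hdr, hlap]
  linarith

end

/-! ### Regularity in space-time, and passage to the limit in the cutoff. -/

section

theorem isOpen_openTimes (T : EReal) : IsOpen (openTimes T) :=
  (isOpen_lt continuous_const continuous_id).inter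
    (isOpen_lt continuous_coe_real_ereal continuous_const)

theorem isOpen_slab (T : EReal) : IsOpen (openTimes T ×ˢ (univ : Set E3)) :=
  (isOpen_openTimes T).prod isOpen_univ

theorem openTimes_subset_times (T : EReal) : openTimes T ⊆ times T := fun _ h => ⟨h.1.le, h.2⟩

theorem Icc_subset_openTimes {T : EReal} {s t : ℝ} (hs : 0 < s) (ht : (t : EReal) < T) :
    Icc s t ⊆ openTimes T := fun _ h =>
  ⟨hs.trans_le h.1, (EReal.coe_le_coe_iff.2 h.2).trans_lt ht⟩

section Slices

variable {F : Type*} [NormedAddCommGroup F] [NormedSpace ℝ F] {T : EReal} {f : ℝ → E3 → F}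

theorem contDiff_slice (hf : ContDiffOn ℝ ∞ (fun q : ℝ × E3 => f q.1 q.2) (openTimes T ×ˢ univ))
    {t : ℝ} (ht : t ∈ openTimes T) : ContDiff ℝ ∞ (f t) :=
  contDiff_iff_contDiffAt.2 fun x =>
    (hf.contDiffAt ((isOpen_slab T).mem_nhds (show (t, x) ∈ _ from ⟨ht, mem_univ x⟩))).comp x
      (f := fun y : E3 => (t, y)) (contDiff_const.prodMk contDiff_id).contDiffAt

theorem hasFDerivAt_slab
    (hf : ContDiffOn ℝ ∞ (fun q : ℝ × E3 => f q.1 q.2) (openTimes T ×ˢ univ))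
    {t : ℝ} (ht : t ∈ openTimes T) (x : E3) :
    HasFDerivAt (fun q : ℝ × E3 => f q.1 q.2)
      (fderiv ℝ (fun q : ℝ × E3 => f q.1 q.2) (t, x)) (t, x) :=
  ((hf.contDiffAt ((isOpen_slab T).mem_nhds
    (show (t, x) ∈ _ from ⟨ht, mem_univ x⟩))).differentiableAt (by norm_num)).hasFDerivAt

theorem continuousOn_fderiv_slab
    (hf : ContDiffOn ℝ ∞ (fun q : ℝ × E3 => f q.1 q.2) (openTimes T ×ˢ univ)) :
    ContinuousOn (fderiv ℝ fun q : ℝ × E3 => f q.1 q.2) (openTimes T ×ˢ univ) :=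
  hf.continuousOn_fderiv_of_isOpen (isOpen_slab T) (by norm_num)

theorem hasDerivAt_time
    (hf : ContDiffOn ℝ ∞ (fun q : ℝ × E3 => f q.1 q.2) (openTimes T ×ˢ univ))
    {t : ℝ} (ht : t ∈ openTimes T) (x : E3) :
    HasDerivAt (fun s => f s x) (fderiv ℝ (fun q : ℝ × E3 => f q.1 q.2) (t, x) (1, 0)) t :=
  (hasFDerivAt_slab hf ht x).comp_hasDerivAt t (f := fun s : ℝ => (s, x))
    ((hasDerivAt_id t).prodMk (hasDerivAt_const t x))

end Slices

section Solution

variable {T : EReal} {v : ℝ → E3 → E3} {Γ₀ : E3 → ℝ} {Γ : ℝ → E3 → ℝ} {Φ A a : ℝ → ℝ}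

theorem pd_slice
    (hf : ContDiffOn ℝ ∞ (fun q : ℝ × E3 => Γ q.1 q.2) (openTimes T ×ˢ univ))
    {t : ℝ} (ht : t ∈ openTimes T) (x : E3) (i : Fin 3) :
    pd i (Γ t) x =
      fderiv ℝ (fun q : ℝ × E3 => Γ q.1 q.2) (t, x) (0, EuclideanSpace.single i 1) := by
  have := ((hasFDerivAt_slab hf ht x).comp x (f := fun y : E3 => (t, y))
    ((hasFDerivAt_const t x).prodMk (hasFDerivAt_id x))).fderiv
  rw [pd, show Γ t = (fun q : ℝ × E3 => Γ q.1 q.2) ∘ fun y : E3 => (t, y) from rfl, this]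
  simp

theorem continuousOn_gradSq
    (hf : ContDiffOn ℝ ∞ (fun q : ℝ × E3 => Γ q.1 q.2) (openTimes T ×ˢ univ)) :
    ContinuousOn (fun q : ℝ × E3 => gradSq (Γ q.1) q.2) (openTimes T ×ˢ univ) := by
  have : ∀ i : Fin 3, ContinuousOn (fun q : ℝ × E3 => pd i (Γ q.1) q.2) (openTimes T ×ˢ univ) :=
    fun i => ((continuousOn_fderiv_slab hf).clm_apply continuousOn_const).congr
      fun q hq => pd_slice hf hq.1 q.2 i
  exact continuousOn_finsetSum _ fun i _ => (this i).pow 2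

theorem hasDerivAt_integral_cut (hP : IsEntropy Φ A a)
    (hf : ContDiffOn ℝ ∞ (fun q : ℝ × E3 => Γ q.1 q.2) (openTimes T ×ˢ univ))
    {t : ℝ} (ht : t ∈ openTimes T) {R : ℝ} (hR : 0 < R) :
    HasDerivAt (fun τ => ∫ x, cut R x * Φ (Γ τ x))
      (∫ x, cut R x * (A (Γ t x) * deriv (fun s => Γ s x) t)) t := by
  obtain ⟨δ, hδ, hsub⟩ := Metric.isOpen_iff.1 (isOpen_openTimes T) t ht
  have hK : IsCompact (Metric.closedBall t (δ / 2) ×ˢ Metric.closedBall (0 : E3) (2 * R)) :=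
    (isCompact_closedBall _ _).prod (isCompact_closedBall _ _)
  have hsub' : Metric.closedBall t (δ / 2) ⊆ openTimes T :=
    (Metric.closedBall_subset_ball (by linarith)).trans hsub
  have hcontD : ContinuousOn (fun q : ℝ × E3 => A (Γ q.1 q.2) *
      fderiv ℝ (fun q : ℝ × E3 => Γ q.1 q.2) q (1, 0)) (openTimes T ×ˢ univ) :=
    (hP.contDiff_deriv.continuous.comp_continuousOn hf.continuousOn).mul
      ((continuousOn_fderiv_slab hf).clm_apply continuousOn_const)
  obtain ⟨M, hM⟩ := hK.exists_bound_of_continuousOn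
    (hcontD.mono (prod_mono hsub' (subset_univ _)))
  have hcut := (contDiff_cut (n := 1) R).continuous
  have hΓc : ∀ τ ∈ openTimes T, Continuous (Γ τ) := fun τ hτ => (contDiff_slice hf hτ).continuous
  have hmain := hasDerivAt_integral_of_dominated_loc_of_deriv_le (μ := (volume : Measure E3))
    (F := fun τ x => cut R x * Φ (Γ τ x)) (x₀ := t)
    (F' := fun τ x => cut R x * (A (Γ τ x) *
      fderiv ℝ (fun q : ℝ × E3 => Γ q.1 q.2) (τ, x) (1, 0)))
    (bound := fun x => cut R x * M) (Metric.ball_mem_nhds t (half_pos hδ))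
    ?_ ?_ ?_ ?_ ?_ ?_
  · have h := hmain.2
    simp only [← (hasDerivAt_time hf ht _).deriv] at h
    exact h
  · filter_upwards [(isOpen_openTimes T).mem_nhds ht] with τ hτ
    exact (hcut.mul (hP.contDiff.continuous.comp (hΓc τ hτ))).aestronglyMeasurable
  · exact integrable_mul_of_compactSupport hcut (hP.contDiff.continuous.comp (hΓc t ht))
      (hasCompactSupport_cut hR)
  · refine (hcut.mul ?_).aestronglyMeasurable
    exact hcontD.comp_continuous (continuous_const.prodMk continuous_id) fun x => ⟨ht, mem_univ x⟩
  · refine Eventually.of_forall fun x τ hτ => ?_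
    rw [norm_mul, Real.norm_of_nonneg (cut_nonneg R x)]
    by_cases hx : 2 * R ≤ ‖x‖
    · simp [cut_eq_zero hR hx]
    · exact mul_le_mul_of_nonneg_left (hM (τ, x) ⟨Metric.ball_subset_closedBall hτ,
        by simpa using (not_le.1 hx).le⟩) (cut_nonneg R x)
  · exact integrable_mul_of_compactSupport hcut continuous_const (hasCompactSupport_cut hR)
  · refine Eventually.of_forall fun x τ hτ => ?_
    have hτ' := hsub' (Metric.ball_subset_closedBall hτ)
    exact ((hP.hasDerivAt _).comp τ (hasDerivAt_time hf hτ' x)).const_mul _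

/-- Extraction of a good time: a Fatou lemma along a convergent sequence of times. -/
theorem exists_time_lintegral_le {s t : ℝ} {f : ℕ → ℝ → E3 → ℝ≥0∞} {f' : ℝ → E3 → ℝ≥0∞}
    {g : ℕ → E3 → ℝ≥0∞} {g' : E3 → ℝ≥0∞} {b : ℕ → ℝ → ℝ≥0∞} {b' c : ℝ≥0∞} (hc : c ≠ ⊤)
    {τ : ℕ → ℝ} (hτ : ∀ n, τ n ∈ Icc s t)
    (hfm : ∀ n, ∀ r ∈ Icc s t, Measurable (f n r)) (hfm' : ∀ r ∈ Icc s t, Measurable (f' r))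
    (hgm : ∀ n, Measurable (g n))
    (hf : ∀ r ∈ Icc s t, ∀ x, Tendsto (fun q : ℕ × ℝ => f q.1 q.2 x)
      (atTop ×ˢ 𝓝[Icc s t] r) (𝓝 (f' r x)))
    (hg : ∀ x, Tendsto (fun n => g n x) atTop (𝓝 (g' x)))
    (hb : ∀ r ∈ Icc s t, Tendsto (fun q : ℕ × ℝ => b q.1 q.2) (atTop ×ˢ 𝓝[Icc s t] r) (𝓝 b'))
    (h : ∀ n, c * (∫⁻ x, f n (τ n) x) + ∫⁻ x, g n x ≤ b n (τ n)) :
    ∃ r ∈ Icc s t, c * (∫⁻ x, f' r x) + ∫⁻ x, g' x ≤ b' := by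
  -- The time supplied by each approximation varies with `n`; compactness of `[s, t]` provides a
  -- limit time. This is why the hypotheses are joint limits in `n` and time.
  obtain ⟨r, hr, σ, hσ, hlim⟩ := isCompact_Icc.tendsto_subseq hτ
  have hq : Tendsto (fun n => (σ n, τ (σ n))) atTop (atTop ×ˢ 𝓝[Icc s t] r) :=
    hσ.tendsto_atTop.prodMk
      (tendsto_nhdsWithin_iff.2 ⟨hlim, Eventually.of_forall fun n => hτ (σ n)⟩)
  refine ⟨r, hr, ?_⟩
  have hm : ∀ n, Measurable fun x => c * f (σ n) (τ (σ n)) x + g (σ n) x := fun n =>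
    ((hfm _ _ (hτ _)).const_mul c).add (hgm _)
  have hp : ∀ x, Tendsto (fun n => c * f (σ n) (τ (σ n)) x + g (σ n) x) atTop
      (𝓝 (c * f' r x + g' x)) := fun x =>
    (ENNReal.Tendsto.const_mul ((hf r hr x).comp hq) (Or.inr hc)).add
      ((hg x).comp hσ.tendsto_atTop)
  calc c * (∫⁻ x, f' r x) + ∫⁻ x, g' x = ∫⁻ x, c * f' r x + g' x := by
        rw [lintegral_add_left ((hfm' r hr).const_mul c), lintegral_const_mul _ (hfm' r hr)]
    _ = ∫⁻ x, liminf (fun n => c * f (σ n) (τ (σ n)) x + g (σ n) x) atTop := by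
        simp only [(hp _).liminf_eq]
    _ ≤ liminf (fun n => ∫⁻ x, c * f (σ n) (τ (σ n)) x + g (σ n) x) atTop :=
        lintegral_liminf_le hm
    _ ≤ liminf (fun n => b (σ n) (τ (σ n))) atTop := by
        refine liminf_le_liminf (Eventually.of_forall fun n => ?_)
        rw [lintegral_add_left ((hfm _ _ (hτ _)).const_mul c),
          lintegral_const_mul _ (hfm _ _ (hτ _))]
        exact h (σ n)
    _ = b' := ((hb r hr).comp hq).liminf_eq

theorem eventually_cut_eq_one (x : E3) : ∀ᶠ n : ℕ in atTop, cut ((n : ℝ) + 1) x = 1 := by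
  obtain ⟨N, hN⟩ := exists_nat_ge ‖x‖
  filter_upwards [eventually_ge_atTop N] with n hn
  refine cut_eq_one (by positivity) (hN.trans ?_)
  have : (N : ℝ) ≤ n := by exact_mod_cast hn
  linarith

theorem tendsto_tail {f : E3 → ℝ} (hf : Integrable f) :
    Tendsto (fun n : ℕ => ∫ x in {x : E3 | (n : ℝ) + 1 ≤ ‖x‖}, f x) atTop (𝓝 0) := by
  have hm : ∀ n : ℕ, MeasurableSet {x : E3 | (n : ℝ) + 1 ≤ ‖x‖} := fun n =>
    measurableSet_le measurable_const measurable_norm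
  have h := tendsto_setIntegral_of_antitone (μ := volume) (f := f) hm
    (fun m n hmn x hx => le_trans (by gcongr) hx.out) ⟨0, hf.integrableOn⟩
  have : ⋂ n : ℕ, {x : E3 | (n : ℝ) + 1 ≤ ‖x‖} = ∅ := by
    ext x
    simp only [mem_iInter, mem_ofPred_eq, mem_empty_iff_false, iff_false, not_forall, not_le]
    obtain ⟨n, hn⟩ := exists_nat_gt ‖x‖
    exact ⟨n, by linarith⟩
  simpa [this] using h

/-- A tail of `Γ(τ)` is at most the `L¹` distance to `Γ(r)` plus the tail of `Γ(r)`. The limit has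
to be joint because the good time depends on the cutoff radius. -/
theorem IsSmoothSolution.tendsto_tail (hΓ : IsSmoothSolution T v Γ₀ Γ) {S : Set ℝ}
    (hS : S ⊆ times T) {r : ℝ} (hr : r ∈ S) :
    Tendsto (fun q : ℕ × ℝ => ∫ x in {x : E3 | (q.1 : ℝ) + 1 ≤ ‖x‖}, |Γ q.2 x|)
      (atTop ×ˢ 𝓝[S] r) (𝓝 0) := by
  have h1 : Tendsto (fun q : ℕ × ℝ => ∫ x, |Γ q.2 x - Γ r x|) (atTop ×ˢ 𝓝[S] r) (𝓝 0) :=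
    ((hΓ.continuous_L1 r (hS hr)).mono_left (nhdsWithin_mono r hS)).comp tendsto_snd
  have h2 : Tendsto (fun q : ℕ × ℝ => ∫ x in {x : E3 | (q.1 : ℝ) + 1 ≤ ‖x‖}, |Γ r x|)
      (atTop ×ˢ 𝓝[S] r) (𝓝 0) :=
    (GammaEq.tendsto_tail (hΓ.integrable r (hS hr)).abs).comp tendsto_fst
  refine squeeze_zero' (Eventually.of_forall fun q => integral_nonneg fun x => abs_nonneg _)
    ?_ (by simpa using h1.add h2)
  filter_upwards [prod_mem_prod univ_mem self_mem_nhdsWithin] with q hq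
  have hq' := hΓ.integrable q.2 (hS hq.2)
  have hr' := hΓ.integrable r (hS hr)
  calc _ ≤ ∫ x in {x : E3 | (q.1 : ℝ) + 1 ≤ ‖x‖}, (|Γ q.2 x - Γ r x| + |Γ r x|) := by
        refine setIntegral_mono hq'.abs.integrableOn
          ((hq'.sub hr').abs.add hr'.abs).integrableOn fun x => ?_
        simpa using abs_add_le (Γ q.2 x - Γ r x) (Γ r x)
    _ = (∫ x in {x : E3 | (q.1 : ℝ) + 1 ≤ ‖x‖}, |Γ q.2 x - Γ r x|) +
        ∫ x in {x : E3 | (q.1 : ℝ) + 1 ≤ ‖x‖}, |Γ r x| :=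
        integral_add (hq'.sub hr').abs.integrableOn hr'.abs.integrableOn
    _ ≤ _ := by
        gcongr
        · exact Eventually.of_forall fun x => abs_nonneg _
        · exact (hq'.sub hr').abs
        · exact Measure.restrict_le_self

end Solution

end

/-! ### Entropy dissipation for entropies of linear growth. -/

section

variable {T : EReal} {v : ℝ → E3 → E3} {Γ₀ : E3 → ℝ} {Γ : ℝ → E3 → ℝ} {Φ A a : ℝ → ℝ}

theorem IsEntropy.integrable_comp (hP : IsEntropy Φ A a) {L : ℝ} (hL : ∀ s, |A s| ≤ L)
    {f : E3 → ℝ} (hf : Integrable f) : Integrable fun x => Φ (f x) := by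
  refine (hf.abs.const_mul L).mono'
    (hP.contDiff.continuous.comp_aestronglyMeasurable hf.aestronglyMeasurable)
    (Eventually.of_forall fun x => ?_)
  rw [Real.norm_of_nonneg (hP.entropy_nonneg _)]
  exact hP.entropy_le hL _

theorem IsSmoothSolution.continuous_slice (hΓ : IsSmoothSolution T v Γ₀ Γ) {t : ℝ}
    (ht : t ∈ openTimes T) : Continuous (Γ t) := (contDiff_slice hΓ.smooth ht).continuous

theorem IsSmoothSolution.contDiff_two (hΓ : IsSmoothSolution T v Γ₀ Γ) {t : ℝ}
    (ht : t ∈ openTimes T) : ContDiff ℝ 2 (Γ t) :=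
  by
  exact_mod_cast contDiff_infty.1 (contDiff_slice hΓ.smooth ht) 2

theorem continuous_gradSq {f : E3 → ℝ} (hf : ContDiff ℝ 1 f) : Continuous (gradSq f) :=
  continuous_finsetSum _ fun i _ => (continuous_pd hf i).pow 2

theorem IsSmoothSolution.continuous_gradSq (hΓ : IsSmoothSolution T v Γ₀ Γ) {t : ℝ}
    (ht : t ∈ openTimes T) : Continuous (gradSq (Γ t)) :=
  GammaEq.continuous_gradSq ((hΓ.contDiff_two ht).of_le (by norm_num))

theorem tendsto_space_time {s t : ℝ} {S : Set ℝ} (hS : IsOpen S) (hsub : Icc s t ⊆ S)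
    {F : ℝ → E3 → ℝ} (hF : ContinuousOn (fun q : ℝ × E3 => F q.1 q.2) (S ×ˢ univ)) {r : ℝ}
    (hr : r ∈ Icc s t) (x : E3) :
    Tendsto (fun q : ℕ × ℝ => F q.2 x) (atTop ×ˢ 𝓝[Icc s t] r) (𝓝 (F r x)) := by
  have h1 : ContinuousAt (fun q : ℝ × E3 => F q.1 q.2) (r, x) :=
    hF.continuousAt ((hS.prod isOpen_univ).mem_nhds ⟨hsub hr, mem_univ x⟩)
  have h2 : Tendsto (fun ρ : ℝ => (ρ, x)) (𝓝[Icc s t] r) (𝓝 (r, x)) :=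
    ((continuous_id.prodMk continuous_const).tendsto' r (r, x) rfl).mono_left
      nhdsWithin_le_nhds
  exact (h1.tendsto.comp h2).comp tendsto_snd

theorem IsSmoothSolution.continuousOn_dissipation (hΓ : IsSmoothSolution T v Γ₀ Γ)
    (ha : Continuous a) :
    ContinuousOn (fun q : ℝ × E3 => a (Γ q.1 q.2) * gradSq (Γ q.1) q.2)
      (openTimes T ×ˢ univ) :=
  (ha.comp_continuousOn hΓ.smooth.continuousOn).mul (continuousOn_gradSq hΓ.smooth)

/-- The mean value theorem replaces integration in time: it turns the entropy inequality at one
intermediate time `r` into a difference of entropies. `M` is independent of `R`, while `r` may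
depend on it. -/
theorem exists_cut_dissipation (hv : IsVelocity T v) (hΓ : IsSmoothSolution T v Γ₀ Γ)
    (hP : IsEntropy Φ A a) {L : ℝ} (hL : ∀ s, |A s| ≤ L) {s t : ℝ} (hs : 0 < s) (hst : s < t)
    (ht : (t : EReal) < T) :
    ∃ M, 0 ≤ M ∧ ∀ R, 1 ≤ R → ∃ r ∈ Icc s t,
      (t - s) * (∫ x, cut R x * (a (Γ r x) * gradSq (Γ r) x)) + ∫ x, cut R x * Φ (Γ t x) ≤
        (∫ x, Φ (Γ s x)) + (t - s) * (M * ∫ x in {x : E3 | R ≤ ‖x‖}, |Γ r x|) := by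
  have hsub := Icc_subset_openTimes hs ht
  have hL0 : 0 ≤ L := (abs_nonneg _).trans (hL 0)
  have hB := profileBound_nonneg
  obtain ⟨K₀, hK₀⟩ := hv.growth s t hs ht
  set K := max K₀ 0
  have hK : ∀ r ∈ Icc s t, ∀ x : E3, ‖v r x‖ ≤ K * (1 + ‖x‖) := fun r hr x =>
    (hK₀ r hr x).trans (by gcongr; exact le_max_left _ _)
  have hK0 : 0 ≤ K := le_max_right _ _
  refine ⟨(26 + 12 * K) * profileBound * L, by positivity, fun R hR => ?_⟩
  have hR0 : 0 < R := by linarith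
  have hder : ∀ r ∈ Icc s t, HasDerivAt (fun τ => ∫ x, cut R x * Φ (Γ τ x))
      (∫ x, cut R x * (A (Γ r x) * deriv (fun s => Γ s x) r)) r := fun r hr =>
    hasDerivAt_integral_cut hP hΓ.smooth (hsub hr) hR0
  obtain ⟨r, hr, hslope⟩ := exists_hasDerivAt_eq_slope (fun τ => ∫ x, cut R x * Φ (Γ τ x)) _ hst
    (fun r hr => (hder r hr).continuousAt.continuousWithinAt)
    (fun r hr => hder r (Ioo_subset_Icc_self hr))
  have hr' := Ioo_subset_Icc_self hr
  have hri := hΓ.integrable r (openTimes_subset_times T (hsub hr'))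
  have hsi := hΓ.integrable s (openTimes_subset_times T (hsub (left_mem_Icc.2 hst.le)))
  refine ⟨r, hr', ?_⟩
  have hg : Continuous fun x => deriv (fun s => Γ s x) r := by
    simp only [(hasDerivAt_time hΓ.smooth (hsub hr') _).deriv]
    exact ((continuousOn_fderiv_slab hΓ.smooth).clm_apply continuousOn_const).comp_continuous
      (continuous_const.prodMk continuous_id) fun x => ⟨hsub hr', mem_univ x⟩
  have hstat := integral_cut_entropy_le hP (hΓ.contDiff_two (hsub hr')) hR hK0
    (by exact_mod_cast contDiff_infty.1 (contDiff_slice hv.smooth (hsub hr')) 1)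
    (hv.div_free r (hsub hr')) (hK r hr') hg (hΓ.equation r (hsub hr'))
    (hP.integrable_comp hL hri)
  have htail : ∫ x in {x : E3 | R ≤ ‖x‖}, Φ (Γ r x) ≤
      L * ∫ x in {x : E3 | R ≤ ‖x‖}, |Γ r x| := by
    rw [← integral_const_mul]
    exact setIntegral_mono (hP.integrable_comp hL hri).integrableOn
      (hri.abs.const_mul L).integrableOn fun x => hP.entropy_le hL _
  have hstart : ∫ x, cut R x * Φ (Γ s x) ≤ ∫ x, Φ (Γ s x) := by
    refine integral_mono_of_nonneg
      (Eventually.of_forall fun x => mul_nonneg (cut_nonneg R x) (hP.entropy_nonneg _))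
      (hP.integrable_comp hL hsi) (Eventually.of_forall fun x => ?_)
    exact mul_le_of_le_one_left (hP.entropy_nonneg _) (cut_le_one R x)
  rw [hslope] at hstat
  have hts : 0 < t - s := sub_pos.2 hst
  rw [div_le_iff₀ hts] at hstat
  have h2 : (26 + 12 * K) * profileBound * ∫ x in {x : E3 | R ≤ ‖x‖}, Φ (Γ r x) ≤
      (26 + 12 * K) * profileBound * L * ∫ x in {x : E3 | R ≤ ‖x‖}, |Γ r x| := by
    rw [mul_assoc _ L]
    gcongr
  have h3 := mul_le_mul_of_nonneg_left h2 hts.le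
  linarith

/-- Entropy dissipation for entropies of linear growth. -/
theorem entropy_dissipation_of_bounded (hv : IsVelocity T v) (hΓ : IsSmoothSolution T v Γ₀ Γ)
    (hP : IsEntropy Φ A a) {L : ℝ} (hL : ∀ s, |A s| ≤ L) {s t : ℝ} (hs : 0 < s) (hst : s < t)
    (ht : (t : EReal) < T) :
    ∃ r ∈ Icc s t, ENNReal.ofReal (t - s) *
        (∫⁻ x, ENNReal.ofReal (a (Γ r x) * gradSq (Γ r) x)) + ∫⁻ x, ENNReal.ofReal (Φ (Γ t x)) ≤
      ∫⁻ x, ENNReal.ofReal (Φ (Γ s x)) := by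
  have hsub := Icc_subset_openTimes hs ht
  have hts : 0 ≤ t - s := (sub_pos.2 hst).le
  obtain ⟨M, hM, hcut⟩ := exists_cut_dissipation hv hΓ hP hL hs hst ht
  choose! τ hτ hτle using hcut
  have hn : ∀ n : ℕ, (1 : ℝ) ≤ (n : ℝ) + 1 := fun n => by simp
  have hcutc : ∀ R, Continuous (cut R) := fun R => (contDiff_cut (n := 0) R).continuous
  have hdis : ∀ r ∈ Icc s t, Continuous fun x => a (Γ r x) * gradSq (Γ r) x := fun r hr =>
    (hP.continuous.comp (hΓ.continuous_slice (hsub hr))).mul (hΓ.continuous_gradSq (hsub hr))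
  have hΦc : ∀ r ∈ Icc s t, Continuous fun x => Φ (Γ r x) := fun r hr =>
    hP.contDiff.continuous.comp (hΓ.continuous_slice (hsub hr))
  -- Radii `n + 1` satisfy `1 ≤ R` from `n = 0` on. The bound `b` contains the tail error, which
  -- vanishes in the joint limit.
  refine exists_time_lintegral_le (τ := fun n : ℕ => τ ((n : ℝ) + 1))
    (f := fun n r x => ENNReal.ofReal (cut ((n : ℝ) + 1) x * (a (Γ r x) * gradSq (Γ r) x)))
    (g := fun n x => ENNReal.ofReal (cut ((n : ℝ) + 1) x * Φ (Γ t x)))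
    (b := fun n r => ENNReal.ofReal ((∫ x, Φ (Γ s x)) +
      (t - s) * (M * ∫ x in {x : E3 | (n : ℝ) + 1 ≤ ‖x‖}, |Γ r x|)))
    ENNReal.ofReal_ne_top (fun n => hτ _ (hn n)) ?_ ?_ ?_ ?_ ?_ ?_ ?_
  · exact fun n r hr => (ENNReal.continuous_ofReal.comp ((hcutc _).mul (hdis r hr))).measurable
  · exact fun r hr => (ENNReal.continuous_ofReal.comp (hdis r hr)).measurable
  · exact fun n => (ENNReal.continuous_ofReal.comp
      ((hcutc _).mul (hΦc t (right_mem_Icc.2 hst.le)))).measurable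
  · intro r hr x
    refine ENNReal.tendsto_ofReal ?_
    refine (tendsto_space_time (F := fun r x => a (Γ r x) * gradSq (Γ r) x)
      (isOpen_openTimes T) hsub (hΓ.continuousOn_dissipation hP.continuous) hr x).congr' ?_
    filter_upwards [tendsto_fst.eventually (eventually_cut_eq_one x)] with q hq
    rw [hq, one_mul]
  · intro x
    refine tendsto_const_nhds.congr' ?_
    filter_upwards [eventually_cut_eq_one x] with n hn
    rw [hn, one_mul]
  · intro r hr
    rw [← ofReal_integral_eq_lintegral_ofReal
      (hP.integrable_comp hL (hΓ.integrable s (openTimes_subset_times T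
        (hsub (left_mem_Icc.2 hst.le)))))
      (Eventually.of_forall fun x => hP.entropy_nonneg _)]
    refine ENNReal.tendsto_ofReal ?_
    simpa using tendsto_const_nhds.add (((hΓ.tendsto_tail
      (hsub.trans (openTimes_subset_times T)) hr).const_mul M).const_mul (t - s))
  · intro n
    have hr := hτ _ (hn n)
    have hn0 : (0 : ℝ) < (n : ℝ) + 1 := by positivity
    rw [← ofReal_integral_eq_lintegral_ofReal
        (integrable_mul_of_compactSupport (hcutc _) (hdis _ hr) (hasCompactSupport_cut hn0))
        (Eventually.of_forall fun x => mul_nonneg (cut_nonneg _ x)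
          (mul_nonneg (hP.nonneg _) (gradSq_nonneg _ x))),
      ← ofReal_integral_eq_lintegral_ofReal
        (integrable_mul_of_compactSupport (hcutc _) (hΦc t (right_mem_Icc.2 hst.le))
          (hasCompactSupport_cut hn0))
        (Eventually.of_forall fun x => mul_nonneg (cut_nonneg _ x) (hP.entropy_nonneg _)),
      ← ENNReal.ofReal_mul hts, ← ENNReal.ofReal_add]
    · exact ENNReal.ofReal_le_ofReal (hτle _ (hn n))
    · exact mul_nonneg hts (integral_nonneg fun x => mul_nonneg (cut_nonneg _ x)
          (mul_nonneg (hP.nonneg _) (gradSq_nonneg _ x)))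
    · exact integral_nonneg fun x => mul_nonneg (cut_nonneg _ x) (hP.entropy_nonneg _)

end

/-! ### Removal of the growth condition on the entropy. -/

section

variable {T : EReal} {v : ℝ → E3 → E3} {Γ₀ : E3 → ℝ} {Γ : ℝ → E3 → ℝ} {Φ A a : ℝ → ℝ}

theorem isEntropy_integral (ha : Continuous a) (ha0 : ∀ s, 0 ≤ a s) :
    IsEntropy (fun s => ∫ y in (0 : ℝ)..s, ∫ z in (0 : ℝ)..y, a z)
      (fun s => ∫ z in (0 : ℝ)..s, a z) a := by
  have h : ∀ s, HasDerivAt (fun s => ∫ z in (0 : ℝ)..s, a z) (a s) s := fun s =>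
    ha.integral_hasStrictDerivAt 0 s |>.hasDerivAt
  have hc : Continuous fun s => ∫ z in (0 : ℝ)..s, a z :=
    continuous_iff_continuousAt.2 fun s => (h s).continuousAt
  exact ⟨fun s => (hc.integral_hasStrictDerivAt 0 s).hasDerivAt, h, ha, ha0, by simp, by simp⟩

/-- An integrable second derivative gives a bounded first derivative, hence an entropy of linear
growth. -/
theorem abs_intervalIntegral_le (ha0 : ∀ s, 0 ≤ a s) (hi : Integrable a) (s : ℝ) :
    |∫ z in (0 : ℝ)..s, a z| ≤ ∫ z, a z := by
  refine (intervalIntegral.norm_integral_le_integral_norm_uIoc (f := a) (μ := volume)).trans ?_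
  simp only [Real.norm_of_nonneg (ha0 _)]
  exact setIntegral_le_integral hi (Eventually.of_forall ha0)

theorem IsEntropy.deriv_eq_integral (hP : IsEntropy Φ A a) (s : ℝ) :
    A s = ∫ z in (0 : ℝ)..s, a z := by
  rw [intervalIntegral.integral_eq_sub_of_hasDerivAt (fun x _ => hP.hasDerivAt' x)
    (hP.continuous.intervalIntegrable _ _), hP.zero', sub_zero]

theorem IsEntropy.eq_integral (hP : IsEntropy Φ A a) (s : ℝ) :
    Φ s = ∫ z in (0 : ℝ)..s, A z := by
  rw [intervalIntegral.integral_eq_sub_of_hasDerivAt (fun x _ => hP.hasDerivAt x)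
    (hP.contDiff_deriv.continuous.intervalIntegrable _ _), hP.zero, sub_zero]

/-- The difference `Ψ - Φ` is itself an entropy, hence nonnegative. -/
theorem IsEntropy.le {Ψ B b : ℝ → ℝ} (hP : IsEntropy Φ A a) (hQ : IsEntropy Ψ B b)
    (hab : ∀ s, a s ≤ b s) (s : ℝ) : Φ s ≤ Ψ s := by
  have : IsEntropy (fun s => Ψ s - Φ s) (fun s => B s - A s) (fun s => b s - a s) :=
    ⟨fun s => (hQ.hasDerivAt s).sub (hP.hasDerivAt s),
      fun s => (hQ.hasDerivAt' s).sub (hP.hasDerivAt' s), hQ.continuous.sub hP.continuous,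
      fun s => sub_nonneg.2 (hab s), by simp [hP.zero, hQ.zero], by simp [hP.zero', hQ.zero']⟩
  exact sub_nonneg.1 (this.entropy_nonneg s)

theorem IsEntropy.congr {Ψ B b : ℝ → ℝ} (hP : IsEntropy Φ A a) (hQ : IsEntropy Ψ B b) {c s : ℝ}
    (hab : ∀ s, |s| ≤ c → a s = b s) (hs : |s| ≤ c) : Φ s = Ψ s := by
  have hmem : ∀ {y s : ℝ}, |s| ≤ c → y ∈ uIcc 0 s → |y| ≤ c := fun {y s} hs hy => by
    have := abs_sub_left_of_mem_uIcc hy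
    simpa using (this.trans (by simpa using hs))
  rw [hP.eq_integral, hQ.eq_integral]
  refine intervalIntegral.integral_congr fun y hy => ?_
  rw [hP.deriv_eq_integral, hQ.deriv_eq_integral]
  exact intervalIntegral.integral_congr fun z hz => hab z (hmem (hmem hs hy) hz)

/-- A continuous truncation, equal to `1` on `[-n, n]` and to `0` off `[-n - 1, n + 1]`. -/
def trunc (n : ℕ) (s : ℝ) : ℝ := max 0 (min 1 ((n : ℝ) + 1 - |s|))

theorem continuous_trunc (n : ℕ) : Continuous (trunc n) := by unfold trunc; fun_prop

theorem trunc_nonneg (n : ℕ) (s : ℝ) : 0 ≤ trunc n s := le_max_left _ _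

theorem trunc_le_one (n : ℕ) (s : ℝ) : trunc n s ≤ 1 := max_le zero_le_one (min_le_left _ _)

theorem trunc_eq_one {n : ℕ} {s : ℝ} (h : |s| ≤ n) : trunc n s = 1 := by
  rw [trunc, min_eq_left (by linarith), max_eq_right zero_le_one]

theorem hasCompactSupport_trunc (n : ℕ) : HasCompactSupport (trunc n) :=
  HasCompactSupport.intro (isCompact_closedBall (0 : ℝ) ((n : ℝ) + 1)) fun s hs => by
    have : (n : ℝ) + 1 < |s| := by simpa using hs
    exact max_eq_left ((min_le_right _ _).trans (by linarith))

/-- Entropy dissipation, without a growth condition on the entropy. -/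
theorem entropy_dissipation (hv : IsVelocity T v) (hΓ : IsSmoothSolution T v Γ₀ Γ)
    (hP : IsEntropy Φ A a) {s t : ℝ} (hs : 0 < s) (hst : s < t) (ht : (t : EReal) < T) :
    ∃ r ∈ Icc s t, ENNReal.ofReal (t - s) *
        (∫⁻ x, ENNReal.ofReal (a (Γ r x) * gradSq (Γ r) x)) + ∫⁻ x, ENNReal.ofReal (Φ (Γ t x)) ≤
      ∫⁻ x, ENNReal.ofReal (Φ (Γ s x)) := by
  have hsub := Icc_subset_openTimes hs ht
  -- Truncating the second derivative instead of `Φ` preserves convexity. The resulting entropies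
  -- have linear growth, lie below `Φ`, and agree with it on `[-n, n]`.
  let an : ℕ → ℝ → ℝ := fun n y => trunc n y * a y
  have hanc : ∀ n, Continuous (an n) := fun n => (continuous_trunc n).mul hP.continuous
  have han0 : ∀ n y, 0 ≤ an n y := fun n y => mul_nonneg (trunc_nonneg n y) (hP.nonneg y)
  have hPn := fun n => isEntropy_integral (hanc n) (han0 n)
  have hbd := fun n => abs_intervalIntegral_le (han0 n)
    ((hanc n).integrable_of_hasCompactSupport (hasCompactSupport_trunc n).mul_right)
  have hev : ∀ (n : ℕ) (y : ℝ), |y| ≤ n → an n y = a y := fun n y hy => by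
    simp only [an, trunc_eq_one hy, one_mul]
  choose τ hτ hτle using fun n => entropy_dissipation_of_bounded hv hΓ (hPn n) (hbd n) hs hst ht
  have hΓc : ∀ r ∈ Icc s t, Continuous (Γ r) := fun r hr => hΓ.continuous_slice (hsub hr)
  refine exists_time_lintegral_le (τ := τ)
    (f := fun n r x => ENNReal.ofReal (an n (Γ r x) * gradSq (Γ r) x))
    (b := fun _ _ => ∫⁻ x, ENNReal.ofReal (Φ (Γ s x)))
    ENNReal.ofReal_ne_top hτ ?_ ?_ ?_ ?_ (fun x => ?_) (fun r _ => tendsto_const_nhds)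
    fun n => (hτle n).trans ?_
  · exact fun n r hr => (ENNReal.continuous_ofReal.comp
      (((hanc n).comp (hΓc r hr)).mul (hΓ.continuous_gradSq (hsub hr)))).measurable
  · exact fun r hr => (ENNReal.continuous_ofReal.comp
      ((hP.continuous.comp (hΓc r hr)).mul (hΓ.continuous_gradSq (hsub hr)))).measurable
  · exact fun n => (ENNReal.continuous_ofReal.comp
      ((hPn n).contDiff.continuous.comp (hΓc t (right_mem_Icc.2 hst.le)))).measurable
  · intro r hr x
    refine ENNReal.tendsto_ofReal ?_
    refine (tendsto_space_time (F := fun r x => a (Γ r x) * gradSq (Γ r) x)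
      (isOpen_openTimes T) hsub (hΓ.continuousOn_dissipation hP.continuous) hr x).congr' ?_
    have h1 := (tendsto_space_time (isOpen_openTimes T) hsub hΓ.smooth.continuousOn hr x).abs
    -- The margin `1` keeps the values of `Γ` at nearby times inside the range where the truncation
    -- is inactive.
    obtain ⟨N, hN⟩ := exists_nat_ge (|Γ r x| + 1)
    filter_upwards [h1.eventually_lt_const (lt_add_one _),
      tendsto_fst.eventually (eventually_ge_atTop N)] with q hq hqN
    have : (N : ℝ) ≤ q.1 := by exact_mod_cast hqN
    rw [hev _ _ (by linarith)]
  · refine ENNReal.tendsto_ofReal (tendsto_const_nhds.congr' ?_)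
    obtain ⟨N, hN⟩ := exists_nat_ge |Γ t x|
    filter_upwards [eventually_ge_atTop N] with n hn
    have : (N : ℝ) ≤ n := by exact_mod_cast hn
    exact hP.congr (hPn n) (fun y hy => (hev n y hy).symm) (hN.trans this)
  · exact lintegral_mono fun x => ENNReal.ofReal_le_ofReal
      ((hPn n).le hP (fun y => mul_le_of_le_one_left (hP.nonneg y) (trunc_le_one n y)) _)

theorem entropy_antitone (hv : IsVelocity T v) (hΓ : IsSmoothSolution T v Γ₀ Γ)
    (hP : IsEntropy Φ A a) {s t : ℝ} (hs : 0 < s) (hst : s ≤ t) (ht : (t : EReal) < T) :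
    ∫⁻ x, ENNReal.ofReal (Φ (Γ t x)) ≤ ∫⁻ x, ENNReal.ofReal (Φ (Γ s x)) := by
  rcases hst.eq_or_lt with rfl | hst
  · exact le_rfl
  · obtain ⟨r, -, h⟩ := entropy_dissipation hv hΓ hP hs hst ht
    exact le_add_self.trans h

end

/-! ### The Sobolev inequality without compact support. -/

section

theorem norm_fderiv_cut_le {R : ℝ} (hR : 0 < R) (x : E3) :
    ‖fderiv ℝ (cut R) x‖ ≤ 8 * profileBound / R := by
  have hB := profileBound_nonneg
  refine le_of_sq_le_sq ((norm_fderiv_sq_le _ _).trans ?_) (by positivity)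
  by_cases hx : ‖x‖ ≤ 2 * R
  · have h : ∀ i, pd i (cut R) x ^ 2 ≤ (4 * profileBound / R) ^ 2 := fun i => by
      rw [pd_cut]
      have h1 : x i ^ 2 ≤ (2 * R) ^ 2 :=
        (coord_sq_le x i).trans (by gcongr)
      have h2 : deriv profile (‖x‖ ^ 2 / R ^ 2) ^ 2 ≤ profileBound ^ 2 :=
        sq_le_sq' (abs_le.1 (abs_deriv_profile_le _)).1 (abs_le.1 (abs_deriv_profile_le _)).2
      calc _ = (2 / R ^ 2) ^ 2 * (x i ^ 2 * deriv profile (‖x‖ ^ 2 / R ^ 2) ^ 2) := by ring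
        _ ≤ (2 / R ^ 2) ^ 2 * ((2 * R) ^ 2 * profileBound ^ 2) := by gcongr
        _ = _ := by field_simp; ring
    calc gradSq (cut R) x ≤ ∑ i : Fin 3, (4 * profileBound / R) ^ 2 :=
          Finset.sum_le_sum fun i _ => h i
      _ ≤ (8 * profileBound / R) ^ 2 := by
        simp only [Finset.sum_const, Finset.card_univ, Fintype.card_fin, nsmul_eq_mul]
        have : 0 ≤ (profileBound / R) ^ 2 := by positivity
        have h1 : (4 * profileBound / R) ^ 2 = 16 * (profileBound / R) ^ 2 := by ring
        have h2 : (8 * profileBound / R) ^ 2 = 64 * (profileBound / R) ^ 2 := by ring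
        rw [h1, h2]
        push_cast
        linarith
  · simp only [gradSq, pd_cut_of_gt hR _ (not_le.1 hx)]
    simp
    positivity

theorem eLpNorm_six_le_of_compactSupport {f : E3 → ℝ} (hf : ContDiff ℝ 1 f)
    (hc : HasCompactSupport f) :
    eLpNorm f 6 volume ≤
      SNormLESNormFDerivOfEqConst ℝ (volume : Measure E3) (2 : NNReal) *
        eLpNorm (fderiv ℝ f) 2 volume := by
  have := eLpNorm_le_eLpNorm_fderiv_of_eq (volume : Measure E3) hf hc (p := 2) (p' := 6)
    (by norm_num) (by simp) (by simp; norm_num)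
  exact_mod_cast this

/-- Applied to `cut · f`, the compactly supported case has the error `f ∇cut`, of `L²` size `O(1/R)`
since `f` is in `L²`. Fatou's lemma handles the left side. -/
theorem eLpNorm_six_le {f : E3 → ℝ} (hf : ContDiff ℝ 1 f) (h2 : eLpNorm f 2 volume ≠ ⊤) :
    eLpNorm f 6 volume ≤
      SNormLESNormFDerivOfEqConst ℝ (volume : Measure E3) (2 : NNReal) *
        eLpNorm (fderiv ℝ f) 2 volume := by
  set C := SNormLESNormFDerivOfEqConst ℝ (volume : Measure E3) (2 : NNReal)
  have hcut : ∀ R, ContDiff ℝ 1 (cut R) := fun R => contDiff_cut (n := 1) R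
  let u : ℕ → E3 → ℝ := fun n x => cut ((n : ℝ) + 1) x * f x
  have hpos : ∀ n : ℕ, (0 : ℝ) < (n : ℝ) + 1 := fun n => by positivity
  have hu : ∀ n, ContDiff ℝ 1 (u n) := fun n => (hcut _).mul hf
  have hdf : Continuous (fderiv ℝ f) := hf.continuous_fderiv (by norm_num)
  have hdcut : ∀ R, Continuous (fderiv ℝ (cut R)) := fun R =>
    (hcut R).continuous_fderiv (by norm_num)
  have hbound : ∀ n, eLpNorm (u n) 6 volume ≤ C * (eLpNorm (fderiv ℝ f) 2 volume +
      ENNReal.ofReal (8 * profileBound / ((n : ℝ) + 1)) * eLpNorm f 2 volume) := fun n => by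
    refine (eLpNorm_six_le_of_compactSupport (hu n)
      (hasCompactSupport_cut (hpos n)).mul_right).trans ?_
    gcongr
    let F : E3 → E3 →L[ℝ] ℝ := fun x => cut ((n : ℝ) + 1) x • fderiv ℝ f x
    let F' : E3 → E3 →L[ℝ] ℝ := fun x => f x • fderiv ℝ (cut ((n : ℝ) + 1)) x
    have hF : AEStronglyMeasurable F volume :=
      (Continuous.smul (hcut _).continuous hdf).aestronglyMeasurable
    have hF' : AEStronglyMeasurable F' volume :=
      (Continuous.smul hf.continuous (hdcut _)).aestronglyMeasurable
    have h1 : fderiv ℝ (u n) = F + F' := by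
      ext1 x
      exact fderiv_fun_mul ((hcut _).differentiable (by norm_num) x)
        (hf.differentiable (by norm_num) x)
    rw [h1]
    refine (eLpNorm_add_le hF hF' one_le_two).trans ?_
    gcongr ?_ + ?_
    · refine eLpNorm_mono fun x => ?_
      rw [norm_smul, Real.norm_of_nonneg (cut_nonneg _ _)]
      exact mul_le_of_le_one_left (norm_nonneg _) (cut_le_one _ _)
    · refine eLpNorm_le_mul_eLpNorm_of_ae_le_mul (Eventually.of_forall fun x => ?_) 2
      rw [norm_smul, mul_comm]
      exact mul_le_mul_of_nonneg_right (norm_fderiv_cut_le (hpos n) x) (norm_nonneg _)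
  have hlim : Tendsto (fun n : ℕ => (C : ℝ≥0∞) * (eLpNorm (fderiv ℝ f) 2 volume +
      ENNReal.ofReal (8 * profileBound / ((n : ℝ) + 1)) * eLpNorm f 2 volume)) atTop
      (𝓝 (C * (eLpNorm (fderiv ℝ f) 2 volume + 0))) := by
    refine ENNReal.Tendsto.const_mul (tendsto_const_nhds.add ?_) (Or.inr ENNReal.coe_ne_top)
    have h1 : Tendsto (fun n : ℕ => 8 * profileBound / ((n : ℝ) + 1)) atTop (𝓝 0) := by
      have := (tendsto_one_div_add_atTop_nhds_zero_nat (𝕜 := ℝ)).const_mul (8 * profileBound)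
      simpa [div_eq_mul_inv] using this
    have := ENNReal.Tendsto.mul_const (ENNReal.tendsto_ofReal h1) (Or.inr h2)
    simpa using this
  rw [add_zero] at hlim
  refine (Lp.eLpNorm_lim_le_liminf_eLpNorm (fun n => (hu n).continuous.aestronglyMeasurable) f
    (Eventually.of_forall fun x => ?_)).trans
    ((liminf_le_liminf (Eventually.of_forall hbound)).trans hlim.liminf_eq.le)
  refine tendsto_const_nhds.congr' ?_
  filter_upwards [eventually_cut_eq_one x] with n hn
  simp only [u, hn, one_mul]

theorem eLpNorm_pow_eq {F : Type*} [NormedAddCommGroup F] (f : E3 → F) (n : ℕ) (hn : n ≠ 0) :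
    eLpNorm f n volume ^ n = ∫⁻ x, ENNReal.ofReal (‖f x‖ ^ n) := by
  have := eLpNorm_nnreal_pow_eq_lintegral (f := f) (μ := (volume : Measure E3)) (p := (n : NNReal))
    (by exact_mod_cast hn)
  simp only [NNReal.coe_natCast, ENNReal.rpow_natCast] at this
  simp only [ENNReal.ofReal_pow (norm_nonneg _), ofReal_norm]
  exact_mod_cast this

/-- The Sobolev inequality on `ℝ³`, for functions which need not have compact support. -/
theorem exists_sobolev : ∃ S : ℝ, 1 ≤ S ∧ ∀ f : E3 → ℝ, ContDiff ℝ 1 f →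
    ∫⁻ x, ENNReal.ofReal (f x ^ 2) ≠ ⊤ →
    ∫⁻ x, ENNReal.ofReal (f x ^ 6) ≤
      ENNReal.ofReal S * (∫⁻ x, ENNReal.ofReal (gradSq f x)) ^ 3 := by
  set C := SNormLESNormFDerivOfEqConst ℝ (volume : Measure E3) (2 : NNReal)
  refine ⟨max 1 ((C : ℝ) ^ 6), le_max_left _ _, fun f hf h2 => ?_⟩
  have e2 := eLpNorm_pow_eq f 2 (by norm_num)
  have e6 := eLpNorm_pow_eq f 6 (by norm_num)
  have d2 := eLpNorm_pow_eq (fderiv ℝ f) 2 (by norm_num)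
  simp only [Real.norm_eq_abs, sq_abs, Even.pow_abs (show Even 6 by decide)] at e2 e6
  have h2' : eLpNorm f 2 volume ≠ ⊤ := fun h => h2 (by
    rw [← e2]
    norm_num [h])
  have hle := eLpNorm_six_le hf h2'
  rw [← e6]
  calc _ ≤ ((C : ℝ≥0∞) * eLpNorm (fderiv ℝ f) 2 volume) ^ 6 := by
        gcongr
        exact_mod_cast hle
    _ = (C : ℝ≥0∞) ^ 6 * (eLpNorm (fderiv ℝ f) (2 : ℕ) volume ^ 2) ^ 3 := by
        rw [mul_pow, ← pow_mul]
        norm_num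
    _ ≤ _ := by
        rw [d2]
        gcongr
        · rw [show (C : ℝ≥0∞) = ENNReal.ofReal (C : ℝ) by simp, ← ENNReal.ofReal_pow C.coe_nonneg]
          exact ENNReal.ofReal_le_ofReal (le_max_right _ _)
        · exact norm_fderiv_sq_le f _

end

section

variable {T : EReal} {v : ℝ → E3 → E3} {Γ₀ : E3 → ℝ} {Γ : ℝ → E3 → ℝ}

theorem isEntropy_pow {n : ℕ} (hn : 1 ≤ n) :
    IsEntropy (fun y => y ^ (2 * n)) (fun y => (2 * n : ℕ) * y ^ (2 * n - 1))
      (fun y => (2 * n : ℕ) * ((2 * n - 1 : ℕ) * y ^ (2 * n - 2))) where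
  hasDerivAt y := hasDerivAt_pow (2 * n) y
  hasDerivAt' y := (hasDerivAt_pow (2 * n - 1) y).const_mul _
  continuous := by fun_prop
  nonneg y := by
    have : Even (2 * n - 2) := ⟨n - 1, by omega⟩
    have := this.pow_nonneg y
    positivity
  zero := by
    have : 2 * n ≠ 0 := by omega
    simp [this]
  zero' := by
    have : 2 * n - 1 ≠ 0 := by omega
    simp [this]

theorem gradSq_comp {ψ : ℝ → ℝ} {d : ℝ} {u : E3 → ℝ} {x : E3} (hψ : HasDerivAt ψ d (u x))
    (hu : DifferentiableAt ℝ u x) : gradSq (fun y => ψ (u y)) x = d ^ 2 * gradSq u x := by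
  simp only [gradSq, pd_comp hψ hu, mul_pow, Finset.mul_sum]

/-- Combination of the entropy dissipation with the Sobolev inequality for `ψ(Γ)`. -/
theorem exists_lintegral_pow_six_le {S : ℝ}
    (hS : ∀ f : E3 → ℝ, ContDiff ℝ 1 f → ∫⁻ x, ENNReal.ofReal (f x ^ 2) ≠ ⊤ →
      ∫⁻ x, ENNReal.ofReal (f x ^ 6) ≤
        ENNReal.ofReal S * (∫⁻ x, ENNReal.ofReal (gradSq f x)) ^ 3)
    (hv : IsVelocity T v) (hΓ : IsSmoothSolution T v Γ₀ Γ) {Φ A a ψ ψ' : ℝ → ℝ}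
    (hP : IsEntropy Φ A a) (hψ : ContDiff ℝ 1 ψ) (hψ' : ∀ y, HasDerivAt ψ (ψ' y) y)
    (hle : ∀ y, ψ' y ^ 2 ≤ a y) {s t : ℝ} (hs : 0 < s) (hst : s < t) (ht : (t : EReal) < T)
    (hfin : ∀ r ∈ Icc s t, ∫⁻ x, ENNReal.ofReal (ψ (Γ r x) ^ 2) ≠ ⊤) :
    ∃ r ∈ Icc s t, ENNReal.ofReal (t - s) ^ 3 * (∫⁻ x, ENNReal.ofReal (ψ (Γ r x) ^ 6)) ≤
      ENNReal.ofReal S * (∫⁻ x, ENNReal.ofReal (Φ (Γ s x))) ^ 3 := by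
  obtain ⟨r, hr, hd⟩ := entropy_dissipation hv hΓ hP hs hst ht
  have hu : ContDiff ℝ 1 (Γ r) :=
    (hΓ.contDiff_two (Icc_subset_openTimes hs ht hr)).of_le (by norm_num)
  refine ⟨r, hr, ?_⟩
  have hgrad : ∫⁻ x, ENNReal.ofReal (gradSq (fun y => ψ (Γ r y)) x) ≤
      ∫⁻ x, ENNReal.ofReal (a (Γ r x) * gradSq (Γ r) x) := by
    refine lintegral_mono fun x => ENNReal.ofReal_le_ofReal ?_
    rw [gradSq_comp (hψ' _) (hu.differentiable (by norm_num) x)]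
    exact mul_le_mul_of_nonneg_right (hle _) (gradSq_nonneg _ _)
  calc _ ≤ ENNReal.ofReal (t - s) ^ 3 * (ENNReal.ofReal S *
        (∫⁻ x, ENNReal.ofReal (gradSq (fun y => ψ (Γ r y)) x)) ^ 3) := by
        gcongr
        exact hS _ (hψ.comp hu) (hfin r hr)
    _ ≤ ENNReal.ofReal (t - s) ^ 3 * (ENNReal.ofReal S *
        (∫⁻ x, ENNReal.ofReal (a (Γ r x) * gradSq (Γ r) x)) ^ 3) := by gcongr
    _ = ENNReal.ofReal S * (ENNReal.ofReal (t - s) *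
        ∫⁻ x, ENNReal.ofReal (a (Γ r x) * gradSq (Γ r) x)) ^ 3 := by ring
    _ ≤ _ := by
        gcongr
        exact le_self_add.trans hd

/-- The gain of integrability from `L^{2n}` to `L^{6n}`. -/
theorem lintegral_pow_gain {S : ℝ} (hS1 : 1 ≤ S)
    (hS : ∀ f : E3 → ℝ, ContDiff ℝ 1 f → ∫⁻ x, ENNReal.ofReal (f x ^ 2) ≠ ⊤ →
      ∫⁻ x, ENNReal.ofReal (f x ^ 6) ≤
        ENNReal.ofReal S * (∫⁻ x, ENNReal.ofReal (gradSq f x)) ^ 3)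
    (hv : IsVelocity T v) (hΓ : IsSmoothSolution T v Γ₀ Γ) {n : ℕ} (hn : 1 ≤ n) {s t : ℝ}
    (hs : 0 < s) (hst : s < t) (ht : (t : EReal) < T) :
    ENNReal.ofReal (t - s) ^ 3 * (∫⁻ x, ENNReal.ofReal (Γ t x ^ (2 * (3 * n)))) ≤
      ENNReal.ofReal S * (∫⁻ x, ENNReal.ofReal (Γ s x ^ (2 * n))) ^ 3 := by
  have hP := isEntropy_pow hn
  by_cases hfin : ∫⁻ x, ENNReal.ofReal (Γ s x ^ (2 * n)) = ⊤
  · rw [hfin, ENNReal.top_pow (by norm_num), ENNReal.mul_top]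
    · exact le_top
    · simpa using by linarith
  have hmono : ∀ r ∈ Icc s t, ∫⁻ x, ENNReal.ofReal (Γ r x ^ (2 * n)) ≤
      ∫⁻ x, ENNReal.ofReal (Γ s x ^ (2 * n)) := fun r hr =>
    entropy_antitone hv hΓ hP hs hr.1 (Icc_subset_openTimes hs ht hr).2
  obtain ⟨r, hr, h⟩ := exists_lintegral_pow_six_le hS hv hΓ hP (ψ := fun y => y ^ n)
    (ψ' := fun y => n * y ^ (n - 1)) (contDiff_id.pow n) (fun y => hasDerivAt_pow n y)
    (fun y => by
      rw [mul_pow, ← pow_mul, ← mul_assoc, show (n - 1) * 2 = 2 * n - 2 by omega]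
      have h1 : (0 : ℝ) ≤ y ^ (2 * n - 2) :=
        (show Even (2 * n - 2) from ⟨n - 1, by omega⟩).pow_nonneg y
      have h2 : (n : ℝ) ^ 2 ≤ (2 * n : ℕ) * (2 * n - 1 : ℕ) := by
        rw [pow_two]
        gcongr <;> omega
      exact mul_le_mul_of_nonneg_right h2 h1) hs hst ht
    (fun r hr => by
      simp only [← pow_mul, mul_comm n 2]
      exact ne_top_of_le_ne_top hfin (hmono r hr))
  refine le_trans ?_ h
  simp only [← pow_mul, show n * 6 = 2 * (3 * n) by ring]
  gcongr 1
  · exact entropy_antitone hv hΓ (isEntropy_pow (by omega)) (hs.trans_le hr.1) hr.2 ht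

/-! ### The `L¹` contraction -/

theorem isEntropy_sqrt {δ : ℝ} (hδ : 0 < δ) :
    IsEntropy (fun y => √(δ ^ 2 + y ^ 2) - δ) (fun y => y / √(δ ^ 2 + y ^ 2))
      (fun y => δ ^ 2 / ((δ ^ 2 + y ^ 2) * √(δ ^ 2 + y ^ 2))) := by
  have hpos : ∀ y : ℝ, 0 < δ ^ 2 + y ^ 2 := fun y => by positivity
  have hd : ∀ y : ℝ, HasDerivAt (fun y => √(δ ^ 2 + y ^ 2)) (y / √(δ ^ 2 + y ^ 2)) y := fun y => by
    have h1 : HasDerivAt (fun y : ℝ => δ ^ 2 + y ^ 2) (2 * y) y := by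
      simpa using (hasDerivAt_pow 2 y).const_add (δ ^ 2)
    refine (h1.sqrt (hpos y).ne').congr_deriv ?_
    field_simp
  refine ⟨fun y => (hd y).sub_const δ, fun y => ?_, ?_, fun y => by positivity, ?_, by simp⟩
  · have hs : √(δ ^ 2 + y ^ 2) ≠ 0 := (Real.sqrt_pos.2 (hpos y)).ne'
    refine ((hasDerivAt_id y).div (hd y) hs).congr_deriv ?_
    have h2 := Real.sq_sqrt (hpos y).le
    have := (hpos y).ne'
    simp only [id]
    rw [div_eq_div_iff (pow_ne_zero 2 hs) (mul_ne_zero this hs)]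
    field_simp
    rw [h2]
    ring
  · refine Continuous.div (by fun_prop) (by fun_prop) fun y => ?_
    have := hpos y
    positivity
  · simp [Real.sqrt_sq hδ.le]

theorem lintegral_abs_antitone (hv : IsVelocity T v) (hΓ : IsSmoothSolution T v Γ₀ Γ) {s t : ℝ}
    (hs : 0 < s) (hst : s ≤ t) (ht : (t : EReal) < T) :
    ∫⁻ x, ENNReal.ofReal |Γ t x| ≤ ∫⁻ x, ENNReal.ofReal |Γ s x| := by
  have hδ : ∀ n : ℕ, (0 : ℝ) < 1 / ((n : ℝ) + 1) := fun n => by positivity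
  have hc := hΓ.continuous_slice (Icc_subset_openTimes hs ht (right_mem_Icc.2 hst))
  have hlim : ∀ x, Tendsto (fun n : ℕ => ENNReal.ofReal
      (√((1 / ((n : ℝ) + 1)) ^ 2 + Γ t x ^ 2) - 1 / ((n : ℝ) + 1))) atTop
      (𝓝 (ENNReal.ofReal |Γ t x|)) := fun x => by
    have hf : Continuous fun δ : ℝ => ENNReal.ofReal (√(δ ^ 2 + Γ t x ^ 2) - δ) :=
      ENNReal.continuous_ofReal.comp (by fun_prop)
    have := (hf.tendsto 0).comp (tendsto_one_div_add_atTop_nhds_zero_nat (𝕜 := ℝ))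
    simpa [Real.sqrt_sq_eq_abs, Function.comp_def] using this
  calc ∫⁻ x, ENNReal.ofReal |Γ t x| = ∫⁻ x, liminf (fun n : ℕ => ENNReal.ofReal
      (√((1 / ((n : ℝ) + 1)) ^ 2 + Γ t x ^ 2) - 1 / ((n : ℝ) + 1))) atTop := by
        simp only [(hlim _).liminf_eq]
    _ ≤ liminf (fun n : ℕ => ∫⁻ x, ENNReal.ofReal
      (√((1 / ((n : ℝ) + 1)) ^ 2 + Γ t x ^ 2) - 1 / ((n : ℝ) + 1))) atTop :=
        lintegral_liminf_le fun n => (ENNReal.continuous_ofReal.comp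
          ((isEntropy_sqrt (hδ n)).contDiff.continuous.comp hc)).measurable
    _ ≤ liminf (fun _ : ℕ => ∫⁻ x, ENNReal.ofReal |Γ s x|) atTop := by
        refine liminf_le_liminf (Eventually.of_forall fun n => ?_)
        refine (entropy_antitone hv hΓ (isEntropy_sqrt (hδ n)) hs hst ht).trans ?_
        refine lintegral_mono fun x => ENNReal.ofReal_le_ofReal ?_
        rw [sub_le_iff_le_add, Real.sqrt_le_left (by have := hδ n; positivity), add_sq, sq_abs]
        have := mul_nonneg (abs_nonneg (Γ s x)) (hδ n).le
        linarith
    _ = _ := by simp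

theorem lintegral_abs_le_initial (hv : IsVelocity T v) (hΓ : IsSmoothSolution T v Γ₀ Γ) {t : ℝ}
    (ht0 : 0 < t) (ht : (t : EReal) < T) :
    ∫⁻ x, ENNReal.ofReal |Γ t x| ≤ ∫⁻ x, ENNReal.ofReal |Γ₀ x| := by
  have hsub : Icc 0 t ⊆ times T := fun s hs =>
    ⟨hs.1, (EReal.coe_le_coe_iff.2 hs.2).trans_lt ht⟩
  have h0 : (0 : ℝ) ∈ times T := hsub (left_mem_Icc.2 ht0.le)
  have hlim : Tendsto (fun s => ENNReal.ofReal ((∫ x, |Γ s x - Γ 0 x|) + ∫ x, |Γ 0 x|))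
      (𝓝[Ioc 0 t] 0) (𝓝 (∫⁻ x, ENNReal.ofReal |Γ₀ x|)) := by
    have h1 := ((hΓ.continuous_L1 0 h0).mono_left (nhdsWithin_mono 0
      (Ioc_subset_Icc_self.trans hsub))).add_const (∫ x, |Γ 0 x|)
    have h2 : ∫⁻ x, ENNReal.ofReal |Γ₀ x| = ENNReal.ofReal (∫ x, |Γ 0 x|) := by
      rw [ofReal_integral_eq_lintegral_ofReal (hΓ.integrable 0 h0).abs
        (Eventually.of_forall fun x => abs_nonneg _)]
      exact lintegral_congr_ae (by filter_upwards [hΓ.initial] with x hx; rw [hx])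
    rw [h2]
    simpa using ENNReal.tendsto_ofReal h1
  have : (𝓝[Ioc 0 t] (0 : ℝ)).NeBot := by
    rw [nhdsWithin_Ioc_eq_nhdsGT ht0]
    infer_instance
  refine ge_of_tendsto hlim ?_
  filter_upwards [self_mem_nhdsWithin] with s hs
  have hi := hΓ.integrable s (hsub (Ioc_subset_Icc_self hs))
  refine (lintegral_abs_antitone hv hΓ hs.1 hs.2 ht).trans ?_
  rw [← ofReal_integral_eq_lintegral_ofReal hi.abs (Eventually.of_forall fun x => abs_nonneg _)]
  refine ENNReal.ofReal_le_ofReal ?_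
  have hi0 := hΓ.integrable 0 h0
  have hsum := integral_add (hi.sub hi0).abs hi0.abs
  simp only [Pi.sub_apply] at hsum
  rw [← hsum]
  refine integral_mono hi.abs ((hi.sub hi0).abs.add hi0.abs) fun x => ?_
  simpa using abs_add_le (Γ s x - Γ 0 x) (Γ 0 x)

end

section

variable {T : EReal} {v : ℝ → E3 → E3} {Γ₀ : E3 → ℝ} {Γ : ℝ → E3 → ℝ}

/-! ### From `L¹` to `L²` -/

theorem IsEntropy.scale {Φ A a : ℝ → ℝ} (hP : IsEntropy Φ A a) {l : ℝ} (hl : 0 < l) :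
    IsEntropy (fun y => l ^ 2 * Φ (y / l)) (fun y => l * A (y / l)) (fun y => a (y / l)) where
  hasDerivAt y := by
    refine (((hP.hasDerivAt (y / l)).scomp y ((hasDerivAt_id y).div_const l)).const_mul
      (l ^ 2)).congr_deriv ?_
    simp only [smul_eq_mul]
    field_simp
  hasDerivAt' y := by
    refine (((hP.hasDerivAt' (y / l)).scomp y ((hasDerivAt_id y).div_const l)).const_mul
      l).congr_deriv ?_
    simp only [smul_eq_mul]
    field_simp
  continuous := hP.continuous.comp (continuous_id.div_const l)
  nonneg y := hP.nonneg _
  zero := by simp [hP.zero]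
  zero' := by simp [hP.zero']

/-- The weight `(1 + y²)^{-1/3}`. -/
def weight (y : ℝ) : ℝ := (1 + y ^ 2) ^ (-(1 / 3) : ℝ)

theorem weight_pos (y : ℝ) : 0 < weight y := Real.rpow_pos_of_pos (by positivity) _

theorem weight_cube (y : ℝ) : weight y ^ 3 = (1 + y ^ 2)⁻¹ := by
  rw [weight, ← Real.rpow_natCast, ← Real.rpow_mul (by positivity), ← Real.rpow_neg_one]
  norm_num

theorem contDiff_weight {n : WithTop ℕ∞} : ContDiff ℝ n weight :=
  (contDiff_const.add (contDiff_id.pow 2)).rpow_const_of_ne fun y => by positivity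

theorem hasDerivAt_weight (y : ℝ) :
    HasDerivAt weight (-(2 / 3) * y * (weight y * (1 + y ^ 2)⁻¹)) y := by
  have h1 : HasDerivAt (fun y : ℝ => 1 + y ^ 2) (2 * y) y := by
    simpa using (hasDerivAt_pow 2 y).const_add 1
  have hpos : 0 < 1 + y ^ 2 := by positivity
  refine (h1.rpow_const (p := -(1 / 3)) (Or.inl hpos.ne')).congr_deriv ?_
  rw [Real.rpow_sub_one hpos.ne', weight]
  field_simp

theorem integrable_weight_sq : Integrable fun y => weight y ^ 2 := by
  have h := integrable_rpow_neg_one_add_norm_sq (E := ℝ) (μ := volume) (r := 4 / 3) (by norm_num)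
  refine h.congr (Eventually.of_forall fun y => ?_)
  simp only [weight, Real.norm_eq_abs, sq_abs]
  rw [← Real.rpow_natCast ((1 + y ^ 2) ^ _), ← Real.rpow_mul (by positivity)]
  norm_num

theorem mul_weight_sq_le (y : ℝ) : (y * weight y) ^ 2 ≤ |y| := by
  have hw := weight_pos y
  have key : |y| * weight y ^ 2 ≤ 1 := by
    refine (pow_le_one_iff_of_nonneg (by positivity) (show 3 ≠ 0 by norm_num)).1 ?_
    have : (|y| * weight y ^ 2) ^ 3 = |y| ^ 3 * ((1 + |y| ^ 2) ^ 2)⁻¹ := by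
      rw [mul_pow, ← pow_mul, show 2 * 3 = 3 * 2 by norm_num, pow_mul, weight_cube, sq_abs, inv_pow]
    rw [this, ← div_eq_mul_inv, div_le_one (by positivity)]
    nlinarith [abs_nonneg y, sq_nonneg (|y| - 1), sq_nonneg (|y| ^ 2),
      mul_nonneg (sq_nonneg |y|) (sq_nonneg (|y| - 1)), sq_nonneg |y|]
  calc (y * weight y) ^ 2 = |y| * (|y| * weight y ^ 2) := by
        rw [mul_pow, ← sq_abs y]; ring
    _ ≤ |y| := mul_le_of_le_one_right (abs_nonneg y) key

theorem sq_le_abs_add_mul_weight_pow (y : ℝ) : y ^ 2 ≤ |y| + 4 * (y * weight y) ^ 6 := by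
  have h6 : (y * weight y) ^ 6 = y ^ 6 * ((1 + y ^ 2) ^ 2)⁻¹ := by
    rw [mul_pow, show 6 = 3 * 2 by norm_num, pow_mul (weight y), weight_cube, inv_pow]
  have h60 : 0 ≤ (y * weight y) ^ 6 := (show Even 6 by decide).pow_nonneg _
  rcases le_total |y| 1 with h | h
  · have : y ^ 2 ≤ |y| := by
      rw [← sq_abs]
      nlinarith [abs_nonneg y]
    linarith
  · have h1 : 1 ≤ y ^ 2 := by
      rw [← sq_abs]
      nlinarith
    have h2 : y ^ 2 ≤ 4 * (y * weight y) ^ 6 := by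
      rw [h6, ← div_eq_mul_inv, mul_div_assoc', le_div_iff₀ (by positivity)]
      have : (1 + y ^ 2) ^ 2 ≤ 4 * (y ^ 2) ^ 2 := by nlinarith
      calc y ^ 2 * (1 + y ^ 2) ^ 2 ≤ y ^ 2 * (4 * (y ^ 2) ^ 2) := by gcongr
        _ = _ := by ring
    linarith [abs_nonneg y]

theorem hasDerivAt_mul_weight (y : ℝ) :
    HasDerivAt (fun y => y * weight y) (weight y * (1 - 2 / 3 * (y ^ 2 * (1 + y ^ 2)⁻¹))) y := by
  refine ((hasDerivAt_id y).mul (hasDerivAt_weight y)).congr_deriv ?_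
  simp only [id]
  ring

theorem deriv_mul_weight_sq_le (y : ℝ) :
    (weight y * (1 - 2 / 3 * (y ^ 2 * (1 + y ^ 2)⁻¹))) ^ 2 ≤ weight y ^ 2 := by
  have h0 : 0 ≤ y ^ 2 * (1 + y ^ 2)⁻¹ := by positivity
  have h1 : y ^ 2 * (1 + y ^ 2)⁻¹ ≤ 1 := by
    rw [← div_eq_mul_inv, div_le_one (by positivity)]
    linarith
  rw [mul_pow]
  refine mul_le_of_le_one_right (sq_nonneg _) ?_
  exact pow_le_one₀ (by linarith) (by linarith)

theorem exists_lintegral_sq_le : ∃ C : ℝ, 1 ≤ C ∧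
    ∀ (T : EReal) (v : ℝ → E3 → E3) (Γ₀ : E3 → ℝ) (Γ : ℝ → E3 → ℝ),
      IsVelocity T v → IsSmoothSolution T v Γ₀ Γ →
      ∀ s t m : ℝ, 0 < s → s < t → (t : EReal) < T → 0 < m →
        ∫⁻ x, ENNReal.ofReal |Γ s x| ≤ ENNReal.ofReal m →
        ∫⁻ x, ENNReal.ofReal (Γ t x ^ 2) ≤
          ENNReal.ofReal (C * m ^ 2 / (t - s) ^ (3 / 2 : ℝ)) := by
  obtain ⟨S, hS1, hS⟩ := exists_sobolev
  set c := ∫ y, weight y ^ 2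
  have hc : 0 ≤ c := integral_nonneg fun y => sq_nonneg _
  refine ⟨1 + 4 * S * c ^ 3, by
    have : 0 ≤ 4 * S * c ^ 3 := by positivity
    linarith, fun T v Γ₀ Γ hv hΓ s t m hs hst ht hm hsm => ?_⟩
  set δ := t - s with hδ
  have hδ0 : 0 < δ := sub_pos.2 hst
  set κ := δ ^ (3 / 2 : ℝ) with hκ
  have hκ0 : 0 < κ := Real.rpow_pos_of_pos hδ0 _
  have hκ2 : κ ^ 2 = δ ^ 3 := by
    rw [hκ, ← Real.rpow_natCast, ← Real.rpow_mul hδ0.le, ← Real.rpow_natCast]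
    norm_num
  set l := m / κ with hl
  have hl0 : 0 < l := by positivity
  have hP₁ := isEntropy_integral (a := fun y => weight y ^ 2) (contDiff_weight (n := 0)|>.continuous.pow 2)
    fun y => sq_nonneg (weight y)
  have hP := hP₁.scale hl0
  have hL : ∀ y, l ^ 2 * (∫ y in (0 : ℝ)..y / l, ∫ z in (0 : ℝ)..y, weight z ^ 2) ≤
      l * c * |y| := fun y => by
    have h := hP₁.entropy_le (abs_intervalIntegral_le (fun y => sq_nonneg (weight y))
      integrable_weight_sq) (y / l)
    rw [abs_div, abs_of_pos hl0] at h
    calc _ ≤ l ^ 2 * (c * (|y| / l)) := by gcongr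
      _ = _ := by field_simp
  have hψ2 : ∀ y, (l * (y / l * weight (y / l))) ^ 2 ≤ l * |y| := fun y => by
    have h := mul_weight_sq_le (y / l)
    rw [abs_div, abs_of_pos hl0] at h
    calc _ = l ^ 2 * (y / l * weight (y / l)) ^ 2 := by ring
      _ ≤ l ^ 2 * (|y| / l) := by gcongr
      _ = _ := by field_simp
  have hL1 : ∀ r ∈ Icc s t, ∫⁻ x, ENNReal.ofReal (l * |Γ r x|) ≤ ENNReal.ofReal (l * m) :=
    fun r hr => by
      simp only [ENNReal.ofReal_mul hl0.le]
      rw [lintegral_const_mul' _ _ ENNReal.ofReal_ne_top]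
      gcongr
      exact (lintegral_abs_antitone hv hΓ hs hr.1 (Icc_subset_openTimes hs ht hr).2).trans hsm
  obtain ⟨r, hr, h6⟩ := exists_lintegral_pow_six_le hS hv hΓ hP
    (ψ := fun y => l * (y / l * weight (y / l)))
    (ψ' := fun y => weight (y / l) * (1 - 2 / 3 * ((y / l) ^ 2 * (1 + (y / l) ^ 2)⁻¹)))
    (contDiff_const.mul ((contDiff_id.div_const l).mul
      (contDiff_weight.comp (contDiff_id.div_const l))))
    (fun y => by
      refine (((hasDerivAt_mul_weight (y / l)).scomp y
        ((hasDerivAt_id y).div_const l)).const_mul l).congr_deriv ?_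
      simp only [smul_eq_mul]
      field_simp)
    (fun y => deriv_mul_weight_sq_le _) hs hst ht
    (fun r hr => ne_top_of_le_ne_top ENNReal.ofReal_ne_top
      ((lintegral_mono fun x => ENNReal.ofReal_le_ofReal (hψ2 _)).trans (hL1 r hr)))
  have hΦ : ∫⁻ x, ENNReal.ofReal (l ^ 2 * (∫ y in (0 : ℝ)..Γ s x / l,
      ∫ z in (0 : ℝ)..y, weight z ^ 2)) ≤ ENNReal.ofReal (l * c * m) := by
    refine (lintegral_mono fun x => ENNReal.ofReal_le_ofReal (hL _)).trans ?_
    have hlc : 0 ≤ l * c := by positivity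
    simp only [ENNReal.ofReal_mul hlc]
    rw [lintegral_const_mul' _ _ ENNReal.ofReal_ne_top]
    gcongr
  have h6' : ∫⁻ x, ENNReal.ofReal ((l * (Γ r x / l * weight (Γ r x / l))) ^ 6) ≤
      ENNReal.ofReal (S * (l * c * m) ^ 3 / δ ^ 3) := by
    rw [ENNReal.ofReal_div_of_pos (by positivity),
      ENNReal.le_div_iff_mul_le (Or.inl (by simpa using by positivity))
        (Or.inl ENNReal.ofReal_ne_top), mul_comm, ENNReal.ofReal_pow hδ0.le,
      ENNReal.ofReal_mul (by linarith), ENNReal.ofReal_pow (by positivity)]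
    refine h6.trans ?_
    gcongr
  have hpt : ∀ y, y ^ 2 ≤ l * |y| + 4 / l ^ 4 * (l * (y / l * weight (y / l))) ^ 6 := fun y => by
    have h := sq_le_abs_add_mul_weight_pow (y / l)
    rw [abs_div, abs_of_pos hl0] at h
    calc y ^ 2 = l ^ 2 * (y / l) ^ 2 := by field_simp
      _ ≤ l ^ 2 * (|y| / l + 4 * (y / l * weight (y / l)) ^ 6) := by gcongr
      _ = _ := by field_simp
  have hΓr := hΓ.continuous_slice (Icc_subset_openTimes hs ht hr)
  have hanti := entropy_antitone hv hΓ (isEntropy_pow le_rfl) (hs.trans_le hr.1) hr.2 ht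
  simp only [mul_one] at hanti
  calc ∫⁻ x, ENNReal.ofReal (Γ t x ^ 2) ≤ ∫⁻ x, ENNReal.ofReal (Γ r x ^ 2) := hanti
    _ ≤ ∫⁻ x, (ENNReal.ofReal (l * |Γ r x|) + ENNReal.ofReal (4 / l ^ 4) *
        ENNReal.ofReal ((l * (Γ r x / l * weight (Γ r x / l))) ^ 6)) := by
        refine lintegral_mono fun x => ?_
        rw [← ENNReal.ofReal_mul (by positivity), ← ENNReal.ofReal_add (by positivity)
          (mul_nonneg (by positivity) ((show Even 6 by decide).pow_nonneg _))]
        exact ENNReal.ofReal_le_ofReal (hpt _)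
    _ = (∫⁻ x, ENNReal.ofReal (l * |Γ r x|)) + ENNReal.ofReal (4 / l ^ 4) *
        ∫⁻ x, ENNReal.ofReal ((l * (Γ r x / l * weight (Γ r x / l))) ^ 6) := by
        rw [lintegral_add_left, lintegral_const_mul' _ _ ENNReal.ofReal_ne_top]
        exact (ENNReal.continuous_ofReal.comp (continuous_const.mul hΓr.abs)).measurable
    _ ≤ ENNReal.ofReal (l * m) + ENNReal.ofReal (4 / l ^ 4) *
        ENNReal.ofReal (S * (l * c * m) ^ 3 / δ ^ 3) := by
        gcongr
        exact hL1 r hr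
    _ = _ := by
        rw [← ENNReal.ofReal_mul (by positivity), ← ENNReal.ofReal_add (by positivity)
          (by positivity), ← hκ2, hl]
        congr 1
        field_simp

end

section

variable {T : EReal} {v : ℝ → E3 → E3} {Γ₀ : E3 → ℝ} {Γ : ℝ → E3 → ℝ}

/-- One step of the iteration, with explicit constants. -/
theorem lintegral_pow_step {S : ℝ} (hS1 : 1 ≤ S)
    (hS : ∀ f : E3 → ℝ, ContDiff ℝ 1 f → ∫⁻ x, ENNReal.ofReal (f x ^ 2) ≠ ⊤ →
      ∫⁻ x, ENNReal.ofReal (f x ^ 6) ≤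
        ENNReal.ofReal S * (∫⁻ x, ENNReal.ofReal (gradSq f x)) ^ 3)
    (hv : IsVelocity T v) (hΓ : IsSmoothSolution T v Γ₀ Γ) {n : ℕ} (hn : 1 ≤ n) {s t b : ℝ}
    (hs : 0 < s) (hst : s < t) (ht : (t : EReal) < T) (hb : 0 ≤ b)
    (h : ∫⁻ x, ENNReal.ofReal (Γ s x ^ (2 * n)) ≤ ENNReal.ofReal b) :
    ∫⁻ x, ENNReal.ofReal (Γ t x ^ (2 * (3 * n))) ≤ ENNReal.ofReal (S * b ^ 3 / (t - s) ^ 3) := by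
  have hts : 0 < t - s := sub_pos.2 hst
  rw [ENNReal.ofReal_div_of_pos (by positivity),
    ENNReal.le_div_iff_mul_le (Or.inl (by simpa using by positivity))
      (Or.inl ENNReal.ofReal_ne_top), mul_comm, ENNReal.ofReal_pow hts.le,
    ENNReal.ofReal_mul (by linarith), ENNReal.ofReal_pow hb]
  refine (lintegral_pow_gain hS1 hS hv hΓ hn hs hst ht).trans ?_
  gcongr

/-- The iteration from `L²` to `L^∞`. -/
theorem ae_sq_le_of_lintegral_sq_le {S : ℝ} (hS1 : 1 ≤ S)
    (hS : ∀ f : E3 → ℝ, ContDiff ℝ 1 f → ∫⁻ x, ENNReal.ofReal (f x ^ 2) ≠ ⊤ →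
      ∫⁻ x, ENNReal.ofReal (f x ^ 6) ≤
        ENNReal.ofReal S * (∫⁻ x, ENNReal.ofReal (gradSq f x)) ^ 3)
    (hv : IsVelocity T v) (hΓ : IsSmoothSolution T v Γ₀ Γ) {t μ M : ℝ} (ht0 : 0 < t)
    (ht : (t : EReal) < T) (hμ : 0 < μ) (hμS : 256 * S * μ ^ 2 = t ^ 3) (hM : 0 < M)
    (h : ∫⁻ x, ENNReal.ofReal (Γ (t / 2) x ^ 2) ≤ ENNReal.ofReal (μ * M)) :
    ∀ᵐ x, Γ t x ^ 2 ≤ M := by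
  let τ : ℕ → ℝ := fun k => t * (1 - (1 / 2) ^ (k + 1))
  have hτt : ∀ k, τ k < t := fun k =>
    mul_lt_of_lt_one_right ht0 (by
      have : (0 : ℝ) < (1 / 2) ^ (k + 1) := by positivity
      linarith)
  have hτ0 : ∀ k, 0 < τ k := fun k => mul_pos ht0 (by
    have : (1 / 2 : ℝ) ^ (k + 1) < 1 := pow_lt_one₀ (by norm_num) (by norm_num) (by omega)
    linarith)
  have hτT : ∀ k, (τ k : EReal) < T := fun k => (EReal.coe_lt_coe_iff.2 (hτt k)).trans ht
  have hdiff : ∀ k, τ (k + 1) - τ k = t / 4 * (1 / 2) ^ k := fun k => by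
    simp only [τ]
    ring
  have hpow : ∀ k : ℕ, 1 ≤ 3 ^ k := fun k => Nat.one_le_pow _ _ (by norm_num)
  have hiter : ∀ k, ∫⁻ x, ENNReal.ofReal (Γ (τ k) x ^ (2 * 3 ^ k)) ≤
      ENNReal.ofReal (μ * (1 / 4) ^ k * M ^ 3 ^ k) := fun k => by
    induction k with
    | zero =>
      have : τ 0 = t / 2 := by simp only [τ]; ring
      simpa [this] using h
    | succ k ih =>
      have hlt : τ k < τ (k + 1) := by
        have := hdiff k
        have : 0 < t / 4 * (1 / 2) ^ k := by positivity
        linarith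
      rw [show 3 ^ (k + 1) = 3 * 3 ^ k by ring]
      refine (lintegral_pow_step hS1 hS hv hΓ (hpow k) (hτ0 k) hlt (hτT _) (by positivity)
        ih).trans (ENNReal.ofReal_le_ofReal ?_)
      rw [hdiff, div_le_iff₀ (by positivity)]
      have e1 : S * (μ * (1 / 4) ^ k * M ^ 3 ^ k) ^ 3 =
          (256 * S * μ ^ 2) * (μ / 256 * M ^ (3 * 3 ^ k) * (1 / 64) ^ k) := by
        rw [show (1 / 64 : ℝ) = (1 / 4) ^ 3 by norm_num, ← pow_mul, mul_comm 3 k, pow_mul (1 / 4),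
          mul_comm 3 (3 ^ k), pow_mul M]
        ring
      have e2 : μ * (1 / 4) ^ (k + 1) * M ^ (3 * 3 ^ k) * (t / 4 * (1 / 2) ^ k) ^ 3 =
          t ^ 3 * (μ / 256 * M ^ (3 * 3 ^ k) * (1 / 32) ^ k) := by
        rw [show (1 / 32 : ℝ) = 1 / 4 * (1 / 2) ^ 3 by norm_num, mul_pow (1 / 4), ← pow_mul,
          mul_comm 3 k, pow_mul (1 / 2)]
        ring
      rw [e1, e2, hμS]
      gcongr
      norm_num
  have hvol : ∀ k, volume {x | M ≤ Γ t x ^ 2} ≤ ENNReal.ofReal (μ * (1 / 4) ^ k) := fun k => by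
    have hMk : 0 < M ^ 3 ^ k := by positivity
    have hmono := (entropy_antitone hv hΓ (isEntropy_pow (hpow k)) (hτ0 k) (hτt k).le ht).trans
      (hiter k)
    have hcheb := mul_meas_ge_le_lintegral (μ := volume)
      (ENNReal.continuous_ofReal.comp ((hΓ.continuous_slice ⟨ht0, ht⟩).pow (2 * 3 ^ k))).measurable
      (ENNReal.ofReal (M ^ 3 ^ k))
    have hsub : {x | M ≤ Γ t x ^ 2} ⊆ {x | ENNReal.ofReal (M ^ 3 ^ k) ≤
        (ENNReal.ofReal ∘ fun x => Γ t x ^ (2 * 3 ^ k)) x} := fun x hx => by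
      refine ENNReal.ofReal_le_ofReal ?_
      show M ^ 3 ^ k ≤ Γ t x ^ (2 * 3 ^ k)
      rw [pow_mul]
      exact pow_le_pow_left₀ hM.le hx _
    have h3 : ENNReal.ofReal (M ^ 3 ^ k) * volume {x | M ≤ Γ t x ^ 2} ≤
        ENNReal.ofReal (M ^ 3 ^ k) * ENNReal.ofReal (μ * (1 / 4) ^ k) := by
      rw [← ENNReal.ofReal_mul hMk.le, mul_comm (M ^ 3 ^ k)]
      exact ((mul_le_mul_right (measure_mono hsub) _).trans hcheb).trans hmono
    exact (ENNReal.mul_le_mul_iff_right (by simpa using hMk) ENNReal.ofReal_ne_top).1 h3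
  have hzero : volume {x | M ≤ Γ t x ^ 2} = 0 := by
    have hlim : Tendsto (fun k : ℕ => ENNReal.ofReal (μ * (1 / 4) ^ k)) atTop (𝓝 0) := by
      have := (tendsto_pow_atTop_nhds_zero_of_lt_one (r := (1 / 4 : ℝ)) (by norm_num)
        (by norm_num)).const_mul μ
      simpa using ENNReal.tendsto_ofReal this
    exact le_antisymm (ge_of_tendsto' hlim hvol) zero_le
  have : ∀ᵐ x, ¬ M ≤ Γ t x ^ 2 := by
    rw [ae_iff]
    simpa using hzero
  filter_upwards [this] with x hx using (not_le.1 hx).le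

theorem exists_ae_abs_le : ∃ C : ℝ, 1 ≤ C ∧
    ∀ (T : EReal) (v : ℝ → E3 → E3) (Γ₀ : E3 → ℝ) (Γ : ℝ → E3 → ℝ),
      IsVelocity T v → IsSmoothSolution T v Γ₀ Γ →
      ∀ t m : ℝ, 0 < t → (t : EReal) < T → 0 < m →
        ∫⁻ x, ENNReal.ofReal |Γ₀ x| ≤ ENNReal.ofReal m →
        ∀ᵐ x, |Γ t x| ≤ C * m / t ^ (3 / 2 : ℝ) := by
  obtain ⟨S, hS1, hS⟩ := exists_sobolev
  obtain ⟨D, hD1, hD⟩ := exists_lintegral_sq_le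
  refine ⟨128 * S * D, by nlinarith, fun T v Γ₀ Γ hv hΓ t m ht0 ht hm hle => ?_⟩
  set κ := t ^ (3 / 2 : ℝ) with hκ
  have hκ0 : 0 < κ := Real.rpow_pos_of_pos ht0 _
  have hκ2 : κ ^ 2 = t ^ 3 := by
    rw [hκ, ← Real.rpow_natCast, ← Real.rpow_mul ht0.le, ← Real.rpow_natCast]
    norm_num
  have hκ4 : (t / 2 - t / 4) ^ (3 / 2 : ℝ) = κ / 8 := by
    rw [show t / 2 - t / 4 = t / 2 ^ (2 : ℝ) by norm_num; ring, Real.div_rpow ht0.le (by positivity),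
      ← Real.rpow_mul (by norm_num), hκ]
    norm_num
  have hsq : √S ^ 2 = S := Real.sq_sqrt (by linarith)
  have hs1 : 1 ≤ √S := Real.one_le_sqrt.2 hS1
  have hT : ∀ s, s ≤ t → (s : EReal) < T := fun s hs => (EReal.coe_le_coe_iff.2 hs).trans_lt ht
  have h2 := hD T v Γ₀ Γ hv hΓ (t / 4) (t / 2) m (by linarith) (by linarith)
    (hT _ (by linarith)) hm
    ((lintegral_abs_le_initial hv hΓ (by linarith) (hT _ (by linarith))).trans hle)
  rw [hκ4] at h2
  have hmain := ae_sq_le_of_lintegral_sq_le hS1 hS hv hΓ (μ := κ / (16 * √S))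
    (M := 128 * √S * D * m ^ 2 / κ ^ 2) ht0 ht (by positivity)
    (by
      rw [div_pow, mul_pow, hsq, ← hκ2]
      field_simp
      norm_num) (by positivity)
    (h2.trans_eq (by
      congr 1
      field_simp
      norm_num))
  filter_upwards [hmain] with x hx
  refine abs_le_of_sq_le_sq (hx.trans ?_) (by positivity)
  rw [div_pow, mul_pow]
  gcongr
  have h3 : √S ≤ S := by nlinarith
  calc 128 * √S * D ≤ 128 * S * D := by gcongr
    _ ≤ (128 * S * D) ^ 2 := le_self_pow₀ (by nlinarith) (by norm_num)

/-! ### Interpolation -/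

theorem eLpNorm_le_of_ae_abs_le {f : E3 → ℝ} {b m : ℝ}
    (hfb : ∀ᵐ x, |f x| ≤ b) (hfm : ∫⁻ x, ENNReal.ofReal |f x| ≤ ENNReal.ofReal m) {p : ℝ≥0∞}
    (hp : 1 ≤ p) :
    eLpNorm f p volume ≤
      ENNReal.ofReal b ^ (1 - (1 / p).toReal) * ENNReal.ofReal m ^ (1 / p).toReal := by
  rcases eq_or_ne p ⊤ with rfl | hpt
  · simp only [ENNReal.div_top, ENNReal.toReal_zero, sub_zero, ENNReal.rpow_one, ENNReal.rpow_zero,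
      mul_one, eLpNorm_exponent_top]
    refine essSup_le_of_ae_le _ ?_
    filter_upwards [hfb] with x hx
    rw [← ofReal_norm]
    exact ENNReal.ofReal_le_ofReal hx
  have hp0 : p ≠ 0 := (zero_lt_one.trans_le hp).ne'
  set q := p.toReal
  have hq : 1 ≤ q := by simpa using ENNReal.toReal_mono hpt hp
  have hq0 : 0 < q := by linarith
  have hpq : (1 / p).toReal = 1 / q := by simp [q]
  rw [eLpNorm_eq_lintegral_rpow_enorm_toReal hp0 hpt, hpq]
  have h1 : ∫⁻ x, ‖f x‖ₑ ^ q ≤ ENNReal.ofReal b ^ (q - 1) * ENNReal.ofReal m := by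
    calc ∫⁻ x, ‖f x‖ₑ ^ q ≤ ∫⁻ x, ENNReal.ofReal b ^ (q - 1) * ENNReal.ofReal |f x| := by
          refine lintegral_mono_ae ?_
          filter_upwards [hfb] with x hx
          rw [← ofReal_norm, Real.norm_eq_abs]
          calc ENNReal.ofReal |f x| ^ q = ENNReal.ofReal |f x| ^ (q - 1) * ENNReal.ofReal |f x| := by
                conv_rhs => rw [← ENNReal.rpow_one (ENNReal.ofReal |f x|), ← ENNReal.rpow_mul]
                rw [one_mul, ← ENNReal.rpow_add_of_nonneg _ _ (by linarith) zero_le_one]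
                ring_nf
            _ ≤ _ := by
                gcongr
      _ = ENNReal.ofReal b ^ (q - 1) * ∫⁻ x, ENNReal.ofReal |f x| :=
          lintegral_const_mul' _ _ (ENNReal.rpow_ne_top_of_nonneg (by linarith)
            ENNReal.ofReal_ne_top)
      _ ≤ _ := by gcongr
  calc (∫⁻ x, ‖f x‖ₑ ^ q) ^ (1 / q) ≤
      (ENNReal.ofReal b ^ (q - 1) * ENNReal.ofReal m) ^ (1 / q) := by gcongr
    _ = _ := by
      rw [ENNReal.mul_rpow_of_nonneg _ _ (by positivity), ← ENNReal.rpow_mul]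
      congr 2
      field_simp

end

end GammaEq

end

theorem proposition4p3 :
    ∃ C : ℝ, 0 < C ∧
      ∀ (p : ℝ≥0∞), 1 ≤ p →
      ∀ (ω₀ ρ₀ : ℝ → ℝ → ℝ),
        Integrable (GammaEq.initRho ρ₀) volume →
        Integrable (GammaEq.initPi ω₀) volume →
      ∀ (T : EReal) (v : ℝ → GammaEq.E3 → GammaEq.E3) (Γ : ℝ → GammaEq.E3 → ℝ),
        GammaEq.IsVelocity T v →
        GammaEq.IsSmoothSolution T v (GammaEq.initGamma ω₀ ρ₀) Γ →
      ∀ t : ℝ, 0 < t → (t : EReal) < T →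
        eLpNorm (Γ t) p volume ≤
          ENNReal.ofReal (C / t ^ ((3 / 2 : ℝ) * (1 - (1 / p).toReal))) *
            eLpNorm (GammaEq.initGamma ω₀ ρ₀) 1 volume := by
  obtain ⟨C, hC1, hC⟩ := GammaEq.exists_ae_abs_le
  refine ⟨C, by linarith, fun p hp ω₀ ρ₀ hρ hπ T v Γ hv hΓ t ht0 ht => ?_⟩
  set Γ₀ := GammaEq.initGamma ω₀ ρ₀
  have hint : Integrable Γ₀ := hπ.sub (hρ.div_const 2)
  have hnorm : eLpNorm Γ₀ 1 volume = ∫⁻ x, ENNReal.ofReal |Γ₀ x| := by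
    simp only [eLpNorm_one_eq_lintegral_enorm, ← ofReal_norm, Real.norm_eq_abs]
  have hfin : eLpNorm Γ₀ 1 volume ≠ ⊤ := (memLp_one_iff_integrable.2 hint).2.ne
  have hL1 := GammaEq.lintegral_abs_le_initial hv hΓ ht0 ht
  rw [← hnorm] at hL1
  obtain ⟨m, hm0', hm⟩ : ∃ m : ℝ, 0 ≤ m ∧ eLpNorm Γ₀ 1 volume = ENNReal.ofReal m :=
    ⟨_, ENNReal.toReal_nonneg, (ENNReal.ofReal_toReal hfin).symm⟩
  rw [hm] at hL1
  rcases hm0'.eq_or_lt with rfl | hm0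
  · rw [ENNReal.ofReal_zero] at hL1
    have hc := (hΓ.continuous_slice (t := t) ⟨ht0, ht⟩)
    have hz := (lintegral_eq_zero_iff
      (ENNReal.continuous_ofReal.comp hc.abs).measurable).1 (le_antisymm hL1 zero_le)
    have hz' : Γ t =ᵐ[volume] 0 := by
      filter_upwards [hz] with x hx
      simpa using hx
    rw [eLpNorm_congr_ae hz', eLpNorm_zero]
    exact zero_le
  have hb := hC T v Γ₀ Γ hv hΓ t m ht0 ht hm0 (by rw [← hnorm, hm])
  have hκ0 : 0 < t ^ (3 / 2 : ℝ) := Real.rpow_pos_of_pos ht0 _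
  refine (GammaEq.eLpNorm_le_of_ae_abs_le hb hL1 hp).trans ?_
  set θ := (1 / p).toReal
  have hθ0 : 0 ≤ θ := ENNReal.toReal_nonneg
  have hθ1 : θ ≤ 1 := ENNReal.toReal_le_of_le_ofReal zero_le_one (by
    simpa using ENNReal.inv_le_one.2 hp)
  rw [hm, ENNReal.ofReal_rpow_of_nonneg (by positivity) (by linarith),
    ENNReal.ofReal_rpow_of_nonneg hm0.le hθ0, ← ENNReal.ofReal_mul (by positivity),
    ← ENNReal.ofReal_mul (by positivity)]
  refine ENNReal.ofReal_le_ofReal ?_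
  have hκθ : 0 < t ^ (3 / 2 * (1 - θ)) := Real.rpow_pos_of_pos ht0 _
  calc (C * m / t ^ (3 / 2 : ℝ)) ^ (1 - θ) * m ^ θ =
      C ^ (1 - θ) / t ^ (3 / 2 * (1 - θ)) * (m ^ (1 - θ) * m ^ θ) := by
        rw [Real.div_rpow (by positivity) hκ0.le, Real.mul_rpow (by linarith) hm0.le,
          ← Real.rpow_mul ht0.le]
        ring
    _ = C ^ (1 - θ) / t ^ (3 / 2 * (1 - θ)) * m := by
        rw [← Real.rpow_add hm0, sub_add_cancel, Real.rpow_one]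
    _ ≤ C / t ^ (3 / 2 * (1 - θ)) * m := by
        gcongr
        calc C ^ (1 - θ) ≤ C ^ (1 : ℝ) := Real.rpow_le_rpow_of_exponent_le hC1 (by linarith)
          _ = C := Real.rpow_one C
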